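/- **Setting.** Let $m \ge 0$ and $1 \le k \le n$ be integers. An *$(m,n,k)$-Magog trapezoid* is an array of positive integers $a_{d,i}$, indexed by the pairs $(d,i)$ with $1 \le d \le k$ and $1 \le i \le n-k+d$, such that * $a_{d,i} \le m+i$ for all $(d,i)$, * $a_{d,i} \le a_{d+1,i}$ and $a_{d,i} \le a_{d,i+1}$ whenever both entries exist. (The array is drawn with $n$ rows, the entry $a_{d,i}$ being in row $i+k-d$; then $d$ numbers the SE-diagonals and $i$ numbers the NE-diagonals, both from left to right.) A *minimum* is an entry $a_{1,i}$ (leftmost SE-diagonal) that is equal to $1$; a *maximum* is an entry $a_{k,i}$ (rightmost SE-diagonal) that is equal to its upper bound $m+i$. Put $N=m+n-1$. All rational expressions in $x_1,\ldots,x_N$ below are regarded as elements of the fraction field of the ring of formal power series $\mathbb{Z}[P][[x_1,\ldots,x_N]]$. If such an element equals $x^{-e} g$ for a monomial $x^{e}$ and a formal power series $g$, its constant term is the coefficient of $x^{e}$ in $g$. Write $[m=0]=1$ if $m=0$ and $[m=0]=0$ otherwise. **Theorem.** Let $m \ge 0$, $1 \le k \le n$ and $0 \le q \le n-k+1$ be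 integers, and suppose that $k\neq 1$ or $m+q \neq 1$. Then the generating function $$\sum_{T} P^{\#\text{maxima of } T},$$ where $T$ runs over all $(m,n,k)$-Magog trapezoids with exactly $q$ minima, is the constant term in $x_1,\ldots,x_{N}$ of $$ P^{[m=0]} \prod_{i=1}^{m+n-1} (1+x_i)^n x_i^{-i-k+2} (1-x_i)^{-1} \prod_{i=\max(m,1)}^{m+n-1} (1+x_i)^{m-i-1}(P x_i+1) \prod_{1 \le i<j \le m+n-1} \frac{x_j-x_i}{1-x_i x_j} \;\times\; S_q, $$ where $$ S_q = \begin{cases} \displaystyle\sum_{i=1}^{k+m+q-2} (1+x_i)^{k+q-n-1}(1-x_i) \prod_{\substack{1 \le j \le m+n-1 \\ j \neq i}} \frac{1-x_i x_j}{x_j-x_i}, & \text{if } q \le n-k,\\[2mm] 1, & \text{if } q=n-k+1, \end{cases} $$ and an empty sum is $0$. (In both cases the expression is of the form $x^{-e}g$ as above, so its constant term is defined.) -/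

import Mathlib

/-- The cells of an `(m,n,k)`-Magog trapezoid. The cell `(d, i)` lies on the `d`-th SE-diagonal
(`1 ≤ d ≤ k`, counted from the left) and on the `i`-th NE-diagonal (`1 ≤ i ≤ n`, counted from the
left), hence in row `i + k - d`; this row has to be one of the `n` rows. -/
def MagogCell (n k d i : ℕ) : Prop :=
  1 ≤ d ∧ d ≤ k ∧ 1 ≤ i ∧ i + k ≤ n + d

/-- `(m,n,k)`-Magog trapezoids: positive integers in the cells, the entries of the `i`-th
NE-diagonal being at most `m + i`, weakly increasing along NE-diagonals and along SE-diagonals.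
`entry d i` is the entry in the cell `(d, i)`; as a convention it is `0` if there is no such
cell. -/
@[ext]
structure MagogTrapezoid (m n k : ℕ) where
  entry : ℕ → ℕ → ℕ
  outside : ∀ d i, ¬ MagogCell n k d i → entry d i = 0
  pos : ∀ d i, MagogCell n k d i → 1 ≤ entry d i
  le_bound : ∀ d i, MagogCell n k d i → entry d i ≤ m + i
  mono_ne : ∀ d i, MagogCell n k d i → MagogCell n k (d + 1) i → entry d i ≤ entry (d + 1) i
  mono_se : ∀ d i, MagogCell n k d i → MagogCell n k d (i + 1) → entry d i ≤ entry d (i + 1)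

namespace MagogTrapezoid

variable {m n k : ℕ}

/-- The number of minima: entries equal to `1` in the leftmost SE-diagonal, which consists of the
cells `(1, i)` with `1 ≤ i ≤ n - k + 1`. -/
def numMinima (T : MagogTrapezoid m n k) : ℕ :=
  ((Finset.Icc 1 (n + 1 - k)).filter fun i => T.entry 1 i = 1).card

/-- The number of maxima: entries in the rightmost SE-diagonal, which consists of the cells
`(k, i)` with `1 ≤ i ≤ n`, that are equal to the upper bound `m + i` of their NE-diagonal. -/
def numMaxima (T : MagogTrapezoid m n k) : ℕ :=
  ((Finset.Icc 1 n).filter fun i => T.entry k i = m + i).card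

instance : Finite (MagogTrapezoid m n k) := by
  have hle : ∀ (T : MagogTrapezoid m n k) (d i : ℕ), T.entry d i < m + n + 1 := by
    intro T d i
    by_cases h : MagogCell n k d i
    · have h1 := T.le_bound d i h
      obtain ⟨_, h2, _, h3⟩ := h
      omega
    · have := T.outside d i h
      omega
  refine Finite.of_injective
    (fun (T : MagogTrapezoid m n k) (d : Fin (k + 1)) (i : Fin (n + 1)) =>
      (⟨T.entry d i, hle T d i⟩ : Fin (m + n + 1))) ?_
  intro T U h
  ext d i
  by_cases hc : MagogCell n k d i
  · have hd : d < k + 1 := by obtain ⟨_, h2, _, h3⟩ := hc; omega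
    have hi : i < n + 1 := by obtain ⟨_, h2, _, h3⟩ := hc; omega
    have := congrFun (congrFun h ⟨d, hd⟩) ⟨i, hi⟩
    simpa using this
  · rw [T.outside d i hc, U.outside d i hc]

noncomputable instance : Fintype (MagogTrapezoid m n k) := Fintype.ofFinite _

end MagogTrapezoid

/-- The generating function of the `(m,n,k)`-Magog trapezoids with `q` minima with respect to the
weight `P ^ (number of maxima)`, a polynomial in `P`. -/
noncomputable def magogGenFun (m n k q : ℕ) : Polynomial ℤ :=
  ∑ T : MagogTrapezoid m n k with T.numMinima = q, Polynomial.X ^ T.numMaxima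

/-- The field in which constant term expressions in the variables `x_i` (`i : σ`) live: the
fraction field of the ring of formal power series in these variables over `ℤ[P]`. -/
abbrev CTField (σ : Type*) : Type _ := FractionRing (MvPowerSeries σ (Polynomial ℤ))

/-- The variable `x_i` as an element of `CTField σ`. -/
noncomputable def ctVar {σ : Type*} (i : σ) : CTField σ :=
  algebraMap (MvPowerSeries σ (Polynomial ℤ)) (CTField σ) (MvPowerSeries.X i)

/-- The parameter `P` as an element of `CTField σ`. -/
noncomputable def ctP (σ : Type*) : CTField σ :=
  algebraMap (MvPowerSeries σ (Polynomial ℤ)) (CTField σ) (MvPowerSeries.C Polynomial.X)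

/-- `f` is a formal Laurent series in the `x_i`, that is `f = x ^ (-e) * g` for a monomial `x ^ e`
and a formal power series `g`, and `c` is its constant term, that is the coefficient of `x ^ e`
in `g`. -/
def HasConstantTerm {σ : Type*} (f : CTField σ) (c : Polynomial ℤ) : Prop :=
  ∃ (e : σ →₀ ℕ) (g : MvPowerSeries σ (Polynomial ℤ)),
    algebraMap (MvPowerSeries σ (Polynomial ℤ)) (CTField σ) (MvPowerSeries.monomial e 1) * f =
      algebraMap (MvPowerSeries σ (Polynomial ℤ)) (CTField σ) g ∧
    MvPowerSeries.coeff e g = c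

/-- An element of `CTField σ` has at most one constant term. -/
theorem HasConstantTerm.unique {σ : Type*} {f : CTField σ} {c c' : Polynomial ℤ}
    (h : HasConstantTerm f c) (h' : HasConstantTerm f c') : c = c' := by
  obtain ⟨e, g, hg, rfl⟩ := h
  obtain ⟨e', g', hg', rfl⟩ := h'
  have key : MvPowerSeries.monomial e' 1 * g = MvPowerSeries.monomial e 1 * g' := by
    apply IsFractionRing.injective (MvPowerSeries σ (Polynomial ℤ)) (CTField σ)
    rw [map_mul, map_mul, ← hg, ← hg']
    ring
  have h1 := MvPowerSeries.coeff_add_monomial_mul e' e g (1 : Polynomial ℤ)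
  have h2 := MvPowerSeries.coeff_add_monomial_mul e e' g' (1 : Polynomial ℤ)
  rw [key, add_comm e' e, h2] at h1
  simpa using h1.symm

/-- The common factor of the constant term expression, in the variables `x_1, …, x_{m+n-1}`.
The variable `x_i` of the mathematical notation is `ctVar i'` with `i' : Fin (m + n - 1)` and
`i = i' + 1`. -/
noncomputable def magogKernel (m n k : ℕ) : CTField (Fin (m + n - 1)) :=
  (if m = 0 then ctP (Fin (m + n - 1)) else 1) *
  (∏ i : Fin (m + n - 1),
    (1 + ctVar i) ^ n * ctVar i ^ (-(((i : ℕ) : ℤ) + 1) - (k : ℤ) + 2) * (1 - ctVar i)⁻¹) *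
  (∏ i ∈ Finset.univ.filter (fun i : Fin (m + n - 1) => max m 1 ≤ (i : ℕ) + 1),
    (1 + ctVar i) ^ ((m : ℤ) - (((i : ℕ) : ℤ) + 1) - 1) *
      (ctP (Fin (m + n - 1)) * ctVar i + 1)) *
  (∏ i : Fin (m + n - 1), ∏ j ∈ Finset.univ.filter (fun j : Fin (m + n - 1) => i < j),
    (ctVar j - ctVar i) / (1 - ctVar i * ctVar j))

/-- The second factor of the constant term expression in the case `q ≤ n - k`. The summation index
`i = i' + 1` runs from `1` to `k + m + q - 2`, which is less than `m + n - 1` in this case. -/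
noncomputable def magogSum (m n k q : ℕ) : CTField (Fin (m + n - 1)) :=
  ∑ i ∈ Finset.univ.filter
      (fun i : Fin (m + n - 1) => ((i : ℕ) : ℤ) + 1 ≤ (k : ℤ) + (m : ℤ) + (q : ℤ) - 2),
    (1 + ctVar i) ^ ((k : ℤ) + (q : ℤ) - (n : ℤ) - 1) * (1 - ctVar i) *
      ∏ j ∈ Finset.univ.filter (fun j : Fin (m + n - 1) => j ≠ i),
        (1 - ctVar i * ctVar j) / (ctVar j - ctVar i)

/-! For each threshold `v + 1`, with `v` from `0` to `m + n - 2`, count row by row the entries that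
do not exceed it, missing entries of short rows counting as `0`. These heights start at `k` and,
since consecutive rows interlace, drop by `0` or `1` per row. Adding `v - 1` turns them into the
strictly increasing positions of non-intersecting paths that start at `v + k - 1`. The bound `m + i`
says that path `v` may go down between the times `s` and `s + 1` only if `v < m + s`. A maximum is a
descent at the first possible moment, `v + 1 = m + s`, except for the forced maximum when `m = 0`.
With `a = k + q - 1 < n`, having `q` minima means that path `0` is at position `0` at time `a` and
loses its last unit of height right afterwards; from then on it is frozen. If `a = n` nothing is
frozen.

Non-intersection comes from antisymmetry. `signSeries` has the sign of `e` as its coefficient at `x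
^ e`, hence `1` at strictly increasing exponents. Multiplication by factors `1 + w x_v` over the
active paths performs one time step, and exponents at which two paths collide drop out because an
antisymmetric series has no such monomials (`coeff_prod_one_add_mul_of_strictMonoOn`). Only the last
active variable carries the weight `P`, so the factors of later steps are symmetric in the active
variables and the argument iterates. By `map_signSeries` the alternating sum equals `∏ (1 - x_i)⁻¹ ∏
(x_j - x_i) / (1 - x_i x_j)`, so the kernel is this path series divided by the monomial of the
starting positions. This settles `q = n - k + 1`.

For `q ≤ n - k`, the `i`-th summand of `S_q` removes `x_i` from `signSeries` and the steps of path
`i` after time `a`. The resulting alternating sum, `cutSeries`, is again antisymmetric in the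
variables that matter. At a strictly increasing exponent only its first term can survive, and only
if the first exponent is `0`: exactly the freezing condition. -/

/-! ### A Lagrange interpolation identity. -/

/-- An evaluation of the interpolation of `∏ (1 - z x)` at the nodes `0`, `-1` and `x ∈ V`. -/
theorem sum_one_sub_mul_prod_erase_div {K : Type*} [Field K] [DecidableEq K] (V : Finset K)
    (h0 : (0 : K) ∉ V) (h1 : (-1 : K) ∉ V) :
    ∑ x ∈ V, (1 - x) * ∏ y ∈ V.erase x, y * ((1 - x * y) / (y - x)) = 1 - ∏ y ∈ V, y := by
  set Q : Polynomial K := ∏ y ∈ V, (1 - Polynomial.C y * Polynomial.X) with hQ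
  have hQe : ∀ z, Q.eval z = ∏ y ∈ V, (1 - z * y) := by
    intro z
    rw [hQ, Polynomial.eval_prod]
    refine Finset.prod_congr rfl fun y _ => ?_
    rw [Polynomial.eval_sub, Polynomial.eval_mul, Polynomial.eval_one, Polynomial.eval_C,
      Polynomial.eval_X, mul_comm]
  have hne : (0 : K) ∉ insert (-1) V := fun h =>
    (Finset.mem_insert.1 h).elim (fun h => neg_ne_zero.2 one_ne_zero h.symm) h0
  have hcard : (insert (0 : K) (insert (-1) V)).card = V.card + 2 := by
    rw [Finset.card_insert_of_notMem hne, Finset.card_insert_of_notMem h1]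
  have hdeg : Q.natDegree ≤ V.card := by
    refine (Polynomial.natDegree_prod_le _ _).trans ?_
    rw [Finset.card_eq_sum_ones]
    refine Finset.sum_le_sum fun y _ => ?_
    compute_degree
  have hlt : Q.degree < ((insert (0 : K) (insert (-1) V)).card : WithBot ℕ) := by
    refine (Polynomial.degree_le_natDegree).trans_lt ?_
    rw [hcard]
    exact_mod_cast (by omega : Q.natDegree < V.card + 2)
  have key := Lagrange.coeff_eq_sum (s := insert (0 : K) (insert (-1) V)) (v := id)
    Function.injective_id.injOn hlt
  -- There are `V.card + 2` nodes and `Q` has degree at most `V.card`, so the top interpolation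
  -- coefficient is `0`. The nodes `0` and `-1` will give the right-hand side. At a node `x` in `V`,
  -- the factor `1 - x ^ 2` of `Q` over the node difference `x + 1` leaves `1 - x`.
  rw [Polynomial.coeff_eq_zero_of_natDegree_lt (by rw [hcard]; omega),
    Finset.sum_insert hne, Finset.sum_insert h1, Finset.erase_insert hne] at key
  have hP : ∏ y ∈ V, y ≠ 0 := Finset.prod_ne_zero_iff.2 fun y hy h => h0 (h ▸ hy)
  have hs : ((-1 : K) ^ V.card) * (-1) ^ V.card = 1 := by
    rw [← mul_pow]; simp
  have t0 : Q.eval (id (0 : K)) / ∏ j ∈ insert (-1) V, (id (0 : K) - id j) =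
      (-1) ^ V.card / ∏ y ∈ V, y := by
    rw [hQe, Finset.prod_insert h1]
    simp only [id, zero_mul, sub_zero, Finset.prod_const_one, zero_sub, neg_neg, one_mul]
    rw [Finset.prod_neg, div_eq_div_iff (mul_ne_zero (by simp) hP) hP]
    linear_combination (-∏ y ∈ V, y) * hs
  have e1 : (insert (0 : K) (insert (-1) V)).erase (-1) = insert 0 V := by
    ext z; simp only [Finset.mem_erase, Finset.mem_insert]
    constructor
    · rintro ⟨a, b | b | b⟩
      exacts [Or.inl b, absurd b a, Or.inr b]
    · rintro (b | b)
      · exact ⟨b ▸ (neg_ne_zero.2 one_ne_zero).symm, Or.inl b⟩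
      · exact ⟨fun h => h1 (h ▸ b), Or.inr (Or.inr b)⟩
  have hP1 : ∏ y ∈ V, (1 + y) ≠ 0 := Finset.prod_ne_zero_iff.2 fun y hy h =>
    h1 ((eq_neg_of_add_eq_zero_right h) ▸ hy)
  have t1 : Q.eval (id (-1 : K)) / ∏ j ∈ (insert (0 : K) (insert (-1) V)).erase (-1),
      (id (-1 : K) - id j) = - (-1) ^ V.card := by
    rw [hQe, e1, Finset.prod_insert h0]
    simp only [id, sub_zero, neg_mul, one_mul, sub_neg_eq_add]
    have : ∏ x ∈ V, (-1 - x) = (-1) ^ V.card * ∏ x ∈ V, (1 + x) := by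
      rw [← Finset.prod_neg]
      exact Finset.prod_congr rfl fun _ _ => by ring
    rw [this, div_eq_iff (neg_ne_zero.2 (mul_ne_zero (by simp) hP1))]
    linear_combination (-∏ y ∈ V, (1 + y)) * hs
  have t2 : ∀ x ∈ V, Q.eval (id x) / ∏ j ∈ (insert (0 : K) (insert (-1) V)).erase x,
      (id x - id j) = - ((-1) ^ V.card / ∏ y ∈ V, y) *
        ((1 - x) * ∏ y ∈ V.erase x, y * ((1 - x * y) / (y - x))) := by
    intro x hx
    have hx0 : x ≠ 0 := fun h => h0 (h ▸ hx)
    have hx1 : x + 1 ≠ 0 := fun h => h1 ((eq_neg_of_add_eq_zero_left h) ▸ hx)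
    have e2 : (insert (0 : K) (insert (-1) V)).erase x = insert 0 (insert (-1) (V.erase x)) := by
      rw [Finset.erase_insert_of_ne hx0.symm, Finset.erase_insert_of_ne]
      rintro rfl; exact h1 hx
    have hV : V.card = (V.erase x).card + 1 := (Finset.card_erase_add_one hx).symm
    rw [hQe, e2, Finset.prod_insert (fun h => hne (Finset.mem_insert.2
      ((Finset.mem_insert.1 h).imp_right Finset.mem_of_mem_erase))),
      Finset.prod_insert fun h => h1 (Finset.mem_of_mem_erase h)]
    simp only [id, sub_zero, sub_neg_eq_add]
    rw [← Finset.mul_prod_erase V _ hx, ← Finset.mul_prod_erase V (fun y => y) hx, hV,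
      Finset.prod_mul_distrib, Finset.prod_div_distrib]
    have hA : ∏ y ∈ V.erase x, y ≠ 0 := Finset.prod_ne_zero_iff.2 fun y hy h =>
      h0 (h ▸ Finset.mem_of_mem_erase hy)
    have hB : ∏ y ∈ V.erase x, (y - x) ≠ 0 := Finset.prod_ne_zero_iff.2 fun y hy h =>
      Finset.ne_of_mem_erase hy (sub_eq_zero.1 h)
    have hC : ∏ y ∈ V.erase x, (x - y) = (-1) ^ (V.erase x).card * ∏ y ∈ V.erase x, (y - x) := by
      rw [← Finset.prod_neg]
      exact Finset.prod_congr rfl fun _ _ => by ring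
    have hs' : (-1 : K) ^ (V.erase x).card * (-1 : K) ^ (V.erase x).card = 1 := by
      rw [← mul_pow]; simp
    obtain ⟨s, hs⟩ : ∃ s, s = (-1 : K) ^ (V.erase x).card := ⟨_, rfl⟩
    rw [← hs] at hs' hC
    have hs0 : s ≠ 0 := left_ne_zero_of_mul_eq_one hs'
    rw [hC, pow_succ, ← hs]
    field_simp
    linear_combination (x ^ 2 - 1) * (∏ y ∈ V.erase x, (1 - x * y)) * hs'
  rw [t0, t1, Finset.sum_congr rfl t2, ← Finset.mul_sum] at key
  obtain ⟨s, hs'⟩ : ∃ s, s = (-1 : K) ^ V.card := ⟨_, rfl⟩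
  rw [← hs'] at key hs
  generalize ∑ x ∈ V, (1 - x) * ∏ y ∈ V.erase x, y * ((1 - x * y) / (y - x)) = S at key ⊢
  have h := congrArg (fun z => z * s * ∏ y ∈ V, y) key
  field_simp at h
  linear_combination h + (1 - ∏ y ∈ V, y - S) * hs

theorem sum_one_sub_mul_prod_erase_div' {ι K : Type*} [Field K] [DecidableEq ι] (V : Finset ι)
    (x : ι → K) (hx : Set.InjOn x V) (h0 : ∀ i ∈ V, x i ≠ 0) (h1 : ∀ i ∈ V, x i ≠ -1) :
    ∑ i ∈ V, (1 - x i) * ∏ j ∈ V.erase i, x j * ((1 - x i * x j) / (x j - x i)) =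
      1 - ∏ i ∈ V, x i := by
  classical
  have key := sum_one_sub_mul_prod_erase_div (V.image x)
    (fun h => let ⟨i, hi, e⟩ := Finset.mem_image.1 h; h0 i hi e)
    (fun h => let ⟨i, hi, e⟩ := Finset.mem_image.1 h; h1 i hi e)
  rw [Finset.sum_image hx, Finset.prod_image hx] at key
  rw [← key]
  refine Finset.sum_congr rfl fun i hi => ?_
  have : (V.image x).erase (x i) = (V.erase i).image x := by
    ext z
    simp only [Finset.mem_erase, Finset.mem_image]
    constructor
    · rintro ⟨h, j, hj, rfl⟩
      exact ⟨j, ⟨fun e => h (e ▸ rfl), hj⟩, rfl⟩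
    · rintro ⟨j, ⟨h, hj⟩, rfl⟩
      exact ⟨fun e => h (hx hj hi e), j, hj, rfl⟩
  rw [this, Finset.prod_image (hx.mono (by simp))]

/-! ### Products over ordered pairs and extraction of one index. -/

section PairProd

variable {ι M : Type*} [LinearOrder ι]

/-- The product of `g i j` over the pairs `i < j` in `V`. -/
def pairProd [CommMonoid M] (V : Finset ι) (g : ι → ι → M) : M :=
  ∏ i ∈ V, ∏ j ∈ V.filter (fun j => i < j), g i j

theorem pairProd_congr [CommMonoid M] {V : Finset ι} {g g' : ι → ι → M}
    (h : ∀ i ∈ V, ∀ j ∈ V, i < j → g i j = g' i j) : pairProd V g = pairProd V g' :=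
  Finset.prod_congr rfl fun i hi => Finset.prod_congr rfl fun j hj =>
    h i hi j (Finset.mem_filter.1 hj).1 (Finset.mem_filter.1 hj).2

theorem pairProd_eq_mul_erase [CommMonoid M] {V : Finset ι} {i : ι} (hi : i ∈ V)
    (g : ι → ι → M) :
    pairProd V g = (∏ j ∈ V.filter (fun j => j < i), g j i) *
      (∏ j ∈ V.filter (fun j => i < j), g i j) * pairProd (V.erase i) g := by
  have h : ∀ a ∈ V.erase i, ∏ j ∈ V.filter (fun j => a < j), g a j =
      (if a < i then g a i else 1) * ∏ j ∈ (V.erase i).filter (fun j => a < j), g a j := by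
    intro a _
    rw [Finset.filter_erase]
    split_ifs with hai
    · rw [Finset.mul_prod_erase _ _ (Finset.mem_filter.2 ⟨hi, hai⟩)]
    · rw [one_mul, Finset.erase_eq_of_notMem]
      exact fun h => hai (Finset.mem_filter.1 h).2
  rw [pairProd, ← Finset.mul_prod_erase V _ hi, Finset.prod_congr rfl h,
    Finset.prod_mul_distrib, ← Finset.prod_filter, Finset.filter_erase,
    Finset.erase_eq_of_notMem (by simp), pairProd, ← mul_assoc]
  congr 1
  exact mul_comm _ _

theorem prod_erase_eq_filter_mul [CommMonoid M] (V : Finset ι) (i : ι) (f : ι → M) :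
    ∏ j ∈ V.erase i, f j =
      (∏ j ∈ V.filter (fun j => j < i), f j) * ∏ j ∈ V.filter (fun j => i < j), f j := by
  rw [← Finset.prod_union]
  · refine Finset.prod_congr ?_ fun _ _ => rfl
    ext j
    simp only [Finset.mem_erase, Finset.mem_union, Finset.mem_filter, ← and_or_left,
      ← lt_or_lt_iff_ne]
    exact and_comm
  · exact Finset.disjoint_filter.2 fun j _ h1 h2 => lt_asymm h1 h2

theorem pairProd_eq_mul_erase_of_antisymm [CommRing M] {V : Finset ι} {i : ι} (hi : i ∈ V)
    {g : ι → ι → M} (hg : ∀ j, g j i = -g i j) :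
    pairProd V g = (-1) ^ (V.filter (fun j => j < i)).card * (∏ j ∈ V.erase i, g i j) *
      pairProd (V.erase i) g := by
  rw [pairProd_eq_mul_erase hi, prod_erase_eq_filter_mul,
    Finset.prod_congr rfl fun j _ => hg j, Finset.prod_neg, mul_assoc ((-1) ^ _)]

theorem pairProd_eq_zero [CommMonoidWithZero M] {V : Finset ι} {i j : ι} (hi : i ∈ V)
    (hj : j ∈ V) (hij : i ≠ j) {g : ι → ι → M} (h : g i j = 0) (h' : g j i = 0) :
    pairProd V g = 0 := by
  rcases hij.lt_or_gt with hlt | hlt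
  · exact Finset.prod_eq_zero hi (Finset.prod_eq_zero (Finset.mem_filter.2 ⟨hj, hlt⟩) h)
  · exact Finset.prod_eq_zero hj (Finset.prod_eq_zero (Finset.mem_filter.2 ⟨hi, hlt⟩) h')

end PairProd

/-! ### The sum of all alternants and its product formula. -/

section SignSeries

variable {σ : Type*}

/-- The indicator exponent of a finite set of variables. -/
noncomputable def unitExp (V : Finset σ) : σ →₀ ℕ := ∑ i ∈ V, Finsupp.single i 1

theorem unitExp_apply [DecidableEq σ] (V : Finset σ) (j : σ) :
    unitExp V j = if j ∈ V then 1 else 0 := by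
  simp [unitExp, Finsupp.single_apply]

theorem unitExp_le_iff {V : Finset σ} {e : σ →₀ ℕ} : unitExp V ≤ e ↔ ∀ j ∈ V, 1 ≤ e j := by
  classical
  rw [Finsupp.le_def]
  refine forall_congr' fun j => ?_
  rw [unitExp_apply]
  split_ifs with h <;> simp [h]

variable [LinearOrder σ] (R : Type*) [CommRing R]

/-- The power series whose coefficient at `x ^ e` is the sign of `e` as a sequence on `V`: the sum
of all alternants in the variables of `V`. -/
noncomputable def signSeries (V : Finset σ) : MvPowerSeries σ R := open Classical in
  fun e => if ∀ i ∉ V, e i = 0 then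
    ((pairProd V fun i j => Int.sign ((e j : ℤ) - e i) : ℤ) : R) else 0

variable {R}

theorem coeff_signSeries {V : Finset σ} {e : σ →₀ ℕ} (h : ∀ i ∉ V, e i = 0) :
    (signSeries R V).coeff e =
      ((pairProd V fun i j => Int.sign ((e j : ℤ) - e i) : ℤ) : R) := by
  rw [MvPowerSeries.coeff_apply, signSeries, if_pos h]

theorem coeff_signSeries_eq_zero {V : Finset σ} {e : σ →₀ ℕ} {i : σ} (hi : i ∉ V)
    (h : e i ≠ 0) : (signSeries R V).coeff e = 0 := by
  rw [MvPowerSeries.coeff_apply, signSeries, if_neg]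
  exact fun h' => h (h' i hi)

theorem signSeries_empty : signSeries R (∅ : Finset σ) = 1 := by
  classical
  ext e
  rw [MvPowerSeries.coeff_one]
  split_ifs with h
  · rw [coeff_signSeries (by simp [h])]
    simp [pairProd]
  · obtain ⟨i, hi⟩ := Finsupp.ne_iff.1 h
    exact coeff_signSeries_eq_zero (by simp) hi

/-- Split the exponents supported in `V` by their zeros on `V`. If there are none, subtracting `1`
everywhere preserves the sign, and the two terms on the left cancel. Two zeros make the sign vanish.
A single zero at `i` leaves positive exponents on `V.erase i`, and moving `i` to the front produces
the power of `-1`. -/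
theorem signSeries_sub_mul_self (V : Finset σ) :
    signSeries R V - MvPowerSeries.monomial (unitExp V) 1 * signSeries R V =
      ∑ i ∈ V, MvPowerSeries.monomial (unitExp (V.erase i))
        ((-1) ^ (V.filter (fun j => j < i)).card) * signSeries R (V.erase i) := by
  ext e
  have hshift : ∀ (W : Finset σ), (∀ i ∈ W, 1 ≤ e i) →
      (pairProd W fun i j => Int.sign (((e - unitExp W) j : ℤ) - ((e - unitExp W) i : ℕ))) =
        pairProd W fun i j => Int.sign ((e j : ℤ) - e i) := by
    intro W hW
    refine pairProd_congr fun i hi j hj _ => ?_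
    have h1 := hW i hi
    have h2 := hW j hj
    simp only [Finsupp.tsub_apply, unitExp_apply, if_pos hi, if_pos hj]
    congr 1
    omega
  simp only [map_sub, map_sum, MvPowerSeries.coeff_monomial_mul, one_mul, unitExp_le_iff]
  by_cases hsup : ∀ i ∉ V, e i = 0
  swap
  · push Not at hsup
    obtain ⟨a, ha, hae⟩ := hsup
    have hz : ∀ W ⊆ V, (signSeries R W).coeff (e - unitExp W) = 0 := by
      intro W hW
      refine coeff_signSeries_eq_zero (fun h => ha (hW h)) ?_
      simpa [unitExp_apply, show a ∉ W from fun h => ha (hW h)] using hae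
    rw [coeff_signSeries_eq_zero ha hae, hz V subset_rfl, Finset.sum_eq_zero]
    · simp
    · intro i _
      rw [hz _ (Finset.erase_subset _ _)]
      simp
  by_cases hpos : ∀ j ∈ V, 1 ≤ e j
  · rw [if_pos hpos, coeff_signSeries hsup, coeff_signSeries, hshift V hpos, sub_self,
      Finset.sum_eq_zero]
    · intro i hi
      rw [coeff_signSeries_eq_zero (i := i) (by simp), mul_zero, ite_self]
      have := hpos i hi
      simp only [Finsupp.tsub_apply, unitExp_apply, Finset.mem_erase]
      simp
      omega
    · intro i hi
      simp [unitExp_apply, hi, hsup i hi]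
  rw [if_neg hpos, sub_zero, coeff_signSeries hsup]
  push Not at hpos
  obtain ⟨i, hi, hei⟩ := hpos
  replace hei : e i = 0 := by omega
  by_cases huniq : ∃ j ∈ V, j ≠ i ∧ e j = 0
  · obtain ⟨j, hj, hji, hej⟩ := huniq
    rw [pairProd_eq_zero hi hj hji.symm (by simp [hei, hej]) (by simp [hei, hej]),
      Finset.sum_eq_zero, Int.cast_zero]
    intro a _
    rw [if_neg]
    intro h
    by_cases hai : i = a
    · have := h j (Finset.mem_erase.2 ⟨by rwa [← hai], hj⟩)
      omega
    · have := h i (Finset.mem_erase.2 ⟨hai, hi⟩)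
      omega
  push Not at huniq
  have hpos' : ∀ j ∈ V.erase i, 1 ≤ e j := fun j hj =>
    Nat.one_le_iff_ne_zero.2 (huniq j (Finset.mem_of_mem_erase hj) (Finset.ne_of_mem_erase hj))
  rw [Finset.sum_eq_single i, if_pos hpos', coeff_signSeries, hshift _ hpos',
    pairProd_eq_mul_erase_of_antisymm hi, Finset.prod_eq_one, mul_one]
  · push_cast
    rfl
  · intro j hj
    have := hpos' j hj
    rw [Int.sign_eq_one_iff_pos]
    omega
  · intro j
    rw [← Int.sign_neg, neg_sub]
  · intro j hj
    by_cases hjV : j ∈ V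
    · obtain rfl : j = i := by simpa [hjV] using hj
      simp [hei]
    · simp [hsup j hjV]
  · intro b _ hb
    rw [if_neg]
    intro h
    have := h i (Finset.mem_erase.2 ⟨hb.symm, hi⟩)
    omega
  · exact fun h => absurd hi h

/-- Both sides satisfy the recursion of `signSeries_sub_mul_self`, which determines them because `1
- ∏ x_i` is nonzero for nonempty `V`. For the product this recursion is
`sum_one_sub_mul_prod_erase_div'`. The statement is the classical formula for the sum of all Schur
functions, multiplied by the Vandermonde product. -/
theorem map_signSeries [Nontrivial R] {K : Type*} [Field K] (f : MvPowerSeries σ R →+* K)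
    (hf : Function.Injective f) (V : Finset σ) :
    f (signSeries R V) = (∏ i ∈ V, (1 - f (MvPowerSeries.X i))⁻¹) *
      pairProd V fun i j => (f (MvPowerSeries.X j) - f (MvPowerSeries.X i)) /
        (1 - f (MvPowerSeries.X i) * f (MvPowerSeries.X j)) := by
  have hone : ∀ φ : MvPowerSeries σ R, MvPowerSeries.constantCoeff φ = 0 → 1 - f φ ≠ 0 := by
    intro φ hφ h
    have h2 := hf (show f (1 - φ) = f 0 by rw [map_sub, map_one, h, map_zero])
    have h3 := congrArg MvPowerSeries.constantCoeff h2
    simp [hφ] at h3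
  set x : σ → K := fun i => f (MvPowerSeries.X i) with hx
  have hxinj : Function.Injective x := fun i j h => MvPowerSeries.X_inj.1 (hf h)
  have hx0 : ∀ i, x i ≠ 0 := by
    intro i h
    have h1 := hf (h.trans (map_zero f).symm)
    have h2 := congrArg (MvPowerSeries.coeff (Finsupp.single i 1)) h1
    simp at h2
  have hx1 : ∀ i, x i ≠ -1 := by
    intro i h
    refine hone (-MvPowerSeries.X i) (by simp) ?_
    rw [map_neg, show f (MvPowerSeries.X i) = -1 from h]
    ring
  have hx2 : ∀ i, 1 - x i ≠ 0 := fun i => hone _ (by simp)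
  have hx3 : ∀ i j, 1 - x i * x j ≠ 0 := fun i j => by
    rw [hx, ← map_mul]
    exact hone _ (by simp)
  have hx4 : ∀ i j, i ≠ j → x j - x i ≠ 0 := fun i j h =>
    sub_ne_zero.2 fun e => h (hxinj e).symm
  have hmon : ∀ (W : Finset σ) (a : R), f (MvPowerSeries.monomial (unitExp W) a) =
      f (MvPowerSeries.C a) * ∏ i ∈ W, x i := by
    intro W a
    rw [hx, ← map_prod, ← map_mul]
    congr 1
    simp only [MvPowerSeries.X, MvPowerSeries.prod_monomial, Finset.prod_const_one]
    rw [← MvPowerSeries.monomial_zero_eq_C_apply, MvPowerSeries.monomial_mul_monomial, zero_add,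
      mul_one]
    rfl
  change f (signSeries R V) = (∏ i ∈ V, (1 - x i)⁻¹) *
    pairProd V fun i j => (x j - x i) / (1 - x i * x j)
  induction V using Finset.strongInduction with
  | H V ih =>
  rcases V.eq_empty_or_nonempty with rfl | hV
  · simp [signSeries_empty, pairProd]
  have hprod : 1 - ∏ i ∈ V, x i ≠ 0 := by
    rw [hx, ← map_prod]
    refine hone _ ?_
    obtain ⟨i, hi⟩ := hV
    rw [map_prod]
    exact Finset.prod_eq_zero hi (by simp)
  apply mul_left_cancel₀ hprod
  have key := congrArg f (signSeries_sub_mul_self (R := R) V)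
  rw [map_sub, map_mul, hmon, map_one, map_one, map_sum] at key
  rw [show (1 - ∏ i ∈ V, x i) * f (signSeries R V) = f (signSeries R V) -
    1 * (∏ i ∈ V, x i) * f (signSeries R V) by ring, key,
    ← sum_one_sub_mul_prod_erase_div' V x hxinj.injOn (fun i _ => hx0 i) (fun i _ => hx1 i),
    Finset.sum_mul]
  refine Finset.sum_congr rfl fun i hi => ?_
  rw [map_mul, hmon, ih _ (Finset.erase_ssubset hi), pairProd_eq_mul_erase_of_antisymm hi,
    ← Finset.mul_prod_erase V _ hi, Finset.prod_mul_distrib]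
  · have h1 : (∏ j ∈ V.erase i, (1 - x i * x j) / (x j - x i)) *
        ∏ j ∈ V.erase i, (x j - x i) / (1 - x i * x j) = 1 := by
      rw [← Finset.prod_mul_distrib]
      refine Finset.prod_eq_one fun j hj => ?_
      have := hx3 i j
      have := hx4 i j (Finset.ne_of_mem_erase hj).symm
      field_simp
    have h2 := mul_inv_cancel₀ (hx2 i)
    simp only [map_pow, map_neg, map_one]
    generalize (∏ j ∈ V.erase i, (1 - x i * x j) / (x j - x i)) = p at h1 ⊢
    generalize (∏ j ∈ V.erase i, (x j - x i) / (1 - x i * x j)) = p' at h1 ⊢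
    generalize (1 - x i)⁻¹ = u at h2 ⊢
    generalize pairProd (V.erase i) (fun i j => (x j - x i) / (1 - x i * x j)) = D
    generalize ((-1 : K) ^ _) = s
    linear_combination (-(s * D * (∏ j ∈ V.erase i, x j) * ∏ j ∈ V.erase i, (1 - x j)⁻¹)) *
      (h1 * (1 - x i) * u + h2)
  · intro j
    rw [mul_comm (x j), ← neg_sub, neg_div]

end SignSeries

/-! ### Exchanging two variables. -/

section Swap

variable {σ : Type*} {R : Type*} [CommRing R]

theorem coeff_renameEquiv (τ : σ ≃ σ) (p : MvPowerSeries σ R) (e : σ →₀ ℕ) :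
    (MvPowerSeries.renameEquiv R τ p).coeff e =
      p.coeff (Finsupp.equivMapDomain τ.symm e) := by
  have h : e = Finsupp.embDomain τ.toEmbedding (Finsupp.equivMapDomain τ.symm e) := by
    ext i
    obtain ⟨j, rfl⟩ := τ.surjective i
    rw [show τ j = τ.toEmbedding j from rfl, Finsupp.embDomain_apply_self]
    simp
  conv_lhs => rw [h]
  exact MvPowerSeries.coeff_embDomain_rename τ.toEmbedding p _

theorem renameEquiv_X (τ : σ ≃ σ) (i : σ) :
    MvPowerSeries.renameEquiv R τ (MvPowerSeries.X i) = MvPowerSeries.X (τ i) :=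
  MvPowerSeries.rename_X _ _

theorem renameEquiv_C (τ : σ ≃ σ) (a : R) :
    MvPowerSeries.renameEquiv R τ (MvPowerSeries.C a) = MvPowerSeries.C a :=
  MvPowerSeries.rename_C _ _

/-- A power series that changes its sign when two variables are exchanged has no monomials in
which these variables have equal exponents. -/
theorem coeff_eq_zero_of_renameEquiv_swap [DecidableEq σ] [IsDomain R] [CharZero R] {a b : σ}
    {B : MvPowerSeries σ R}
    (hB : MvPowerSeries.renameEquiv R (Equiv.swap a b) B = -B) {e : σ →₀ ℕ} (he : e a = e b) :
    B.coeff e = 0 := by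
  have h := coeff_renameEquiv (Equiv.swap a b) B e
  rw [hB, map_neg, show Finsupp.equivMapDomain (Equiv.swap a b).symm e = e from ?_] at h
  · exact CharZero.neg_eq_self_iff.1 h
  · ext i
    rw [Finsupp.equivMapDomain_apply, Equiv.symm_symm, Equiv.swap_apply_def]
    split_ifs with h1 h2
    · rw [h1, he]
    · rw [h2, he]
    · rfl

variable [LinearOrder σ]

theorem renameEquiv_swap_signSeries {V : Finset σ} {a b : σ} (ha : a ∈ V) (hb : b ∈ V)
    (hab : a ≠ b) :
    MvPowerSeries.renameEquiv R (Equiv.swap a b) (signSeries R V) = -signSeries R V := by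
  ext e
  rw [coeff_renameEquiv, map_neg]
  by_cases hsup : ∀ i ∉ V, e i = 0
  · have hτ : ∀ i ∉ V, (Equiv.swap a b) i = i := fun i hi =>
      Equiv.swap_apply_of_ne_of_ne (fun h => hi (h ▸ ha)) (fun h => hi (h ▸ hb))
    rw [coeff_signSeries hsup, coeff_signSeries]
    · have hb' : b ∈ V.erase a := Finset.mem_erase.2 ⟨hab.symm, hb⟩
      have hanti : ∀ x y : ℤ, Int.sign (x - y) = -Int.sign (y - x) := by
        intro x y
        rw [← Int.sign_neg, neg_sub]
      simp only [Finsupp.equivMapDomain_apply, Equiv.symm_symm]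
      rw [pairProd_eq_mul_erase_of_antisymm ha (fun j => hanti _ _),
        pairProd_eq_mul_erase_of_antisymm hb' (fun j => hanti _ _),
        ← Finset.mul_prod_erase (V.erase a) _ hb',
        pairProd_eq_mul_erase_of_antisymm ha (fun j => hanti _ _),
        pairProd_eq_mul_erase_of_antisymm hb' (fun j => hanti _ _),
        ← Finset.mul_prod_erase (V.erase a) _ hb']
      have hfix : ∀ i ∈ (V.erase a).erase b, Equiv.swap a b i = i := fun i hi =>
        Equiv.swap_apply_of_ne_of_ne (Finset.ne_of_mem_erase (Finset.mem_of_mem_erase hi))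
          (Finset.ne_of_mem_erase hi)
      rw [Finset.prod_congr rfl fun i hi => by rw [hfix i hi],
        Finset.prod_congr (s₁ := (V.erase a).erase b)
          (f := fun i => Int.sign ((e (Equiv.swap a b i) : ℤ) - e (Equiv.swap a b b)))
          rfl fun i hi => by rw [hfix i hi],
        pairProd_congr (V := (V.erase a).erase b) fun i hi j hj _ => by rw [hfix i hi, hfix j hj],
        Equiv.swap_apply_left, Equiv.swap_apply_right, hanti (e a) (e b)]
      push_cast
      ring
    · intro i hi
      rw [Finsupp.equivMapDomain_apply, Equiv.symm_symm, hτ i hi, hsup i hi]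
  · push Not at hsup
    obtain ⟨i, hi, hei⟩ := hsup
    rw [coeff_signSeries_eq_zero hi hei, coeff_signSeries_eq_zero hi, neg_zero]
    have hia : i ≠ a := fun h => hi (h ▸ ha)
    have hib : i ≠ b := fun h => hi (h ▸ hb)
    rwa [Finsupp.equivMapDomain_apply, Equiv.symm_symm, Equiv.swap_apply_of_ne_of_ne hia hib]

/-- The variable `b` takes over the role of `a`, moving past the variables in between. The two
cardinalities are the numbers of sign changes needed to bring it to the front before and after. -/
theorem renameEquiv_swap_signSeries_erase [Fintype σ] {a b : σ} (hab : a ≠ b) :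
    MvPowerSeries.renameEquiv R (Equiv.swap a b) (signSeries R (Finset.univ.erase a)) =
      (-1) ^ (((Finset.univ.erase a).filter (fun j => j < b)).card +
        ((Finset.univ.erase b).filter (fun j => j < a)).card) *
        signSeries R (Finset.univ.erase b) := by
  ext e
  rw [coeff_renameEquiv, ← map_one MvPowerSeries.C, ← map_neg, ← map_pow,
    MvPowerSeries.coeff_C_mul]
  by_cases hsup : e b = 0
  · rw [coeff_signSeries (V := Finset.univ.erase b), coeff_signSeries]
    · have hb' : b ∈ Finset.univ.erase a := by simp [hab.symm]
      have ha' : a ∈ Finset.univ.erase b := by simp [hab]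
      have hanti : ∀ x y : ℤ, Int.sign (x - y) = -Int.sign (y - x) := by
        intro x y
        rw [← Int.sign_neg, neg_sub]
      simp only [Finsupp.equivMapDomain_apply, Equiv.symm_symm]
      rw [pairProd_eq_mul_erase_of_antisymm hb' (fun j => hanti _ _),
        pairProd_eq_mul_erase_of_antisymm ha' (fun j => hanti _ _),
        Finset.erase_right_comm]
      have hfix : ∀ i ∈ (Finset.univ.erase b).erase a, Equiv.swap a b i = i := fun i hi =>
        Equiv.swap_apply_of_ne_of_ne (Finset.ne_of_mem_erase hi)
          (Finset.ne_of_mem_erase (Finset.mem_of_mem_erase hi))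
      rw [Finset.prod_congr rfl fun i hi => by rw [hfix i hi],
        pairProd_congr (V := (Finset.univ.erase b).erase a)
          fun i hi j hj _ => by rw [hfix i hi, hfix j hj], Equiv.swap_apply_right]
      have hs : ∀ p : ℕ, ((-1 : R) ^ p) * (-1) ^ p = 1 := fun p => by rw [← mul_pow]; simp
      push_cast
      rw [pow_add]
      linear_combination (exp := 1) (-(-1) ^ (((Finset.univ.erase a).filter (fun j => j < b)).card) *
        (∏ x ∈ (Finset.univ.erase b).erase a, (((e x : ℤ) - e a).sign : R)) *
        ((pairProd ((Finset.univ.erase b).erase a)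
          fun i j => Int.sign ((e j : ℤ) - e i) : ℤ) : R)) *
        hs (((Finset.univ.erase b).filter (fun j => j < a)).card)
    · intro i hi
      obtain rfl : i = a := by simpa using hi
      simpa using hsup
    · intro i hi
      obtain rfl : i = b := by simpa using hi
      exact hsup
  · rw [coeff_signSeries_eq_zero (i := b) (by simp) hsup,
      coeff_signSeries_eq_zero (i := a) (by simp), mul_zero]
    simpa using hsup

end Swap

/-! ### One time step as multiplication by linear factors. -/

section Steps

variable {σ : Type*} {R : Type*} [CommRing R]

theorem coeff_prod_one_add_mul [DecidableEq σ] (S : Finset σ) (w : σ → R)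
    (B : MvPowerSeries σ R) (l : σ →₀ ℕ) :
    ((∏ v ∈ S, (1 + MvPowerSeries.C (w v) * MvPowerSeries.X v)) * B).coeff l =
      ∑ u ∈ S.powerset.filter (fun u => unitExp u ≤ l),
        (∏ v ∈ u, w v) * B.coeff (l - unitExp u) := by
  rw [Finset.prod_one_add, Finset.sum_mul, map_sum, Finset.sum_filter]
  refine Finset.sum_congr rfl fun u _ => ?_
  rw [show ∏ v ∈ u, (MvPowerSeries.C (w v) * MvPowerSeries.X v) =
    MvPowerSeries.monomial (unitExp u) (∏ v ∈ u, w v) from ?_, MvPowerSeries.coeff_monomial_mul]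
  simp only [MvPowerSeries.X, ← MvPowerSeries.monomial_zero_eq_C_apply,
    MvPowerSeries.monomial_mul_monomial, zero_add, mul_one, MvPowerSeries.prod_monomial]
  rfl

/-- Multiplying an alternating power series by factors `1 + w x` moves a strictly increasing
exponent to strictly increasing ones. -/
theorem coeff_prod_one_add_mul_of_strictMonoOn [LinearOrder σ] [IsDomain R] [CharZero R]
    {V S : Finset σ} (hS : ∀ i ∈ V, ∀ j ∈ S, i < j → i ∈ S) (w : σ → R)
    {B : MvPowerSeries σ R}
    (hB : ∀ i ∈ S, ∀ j ∈ S, i ≠ j → MvPowerSeries.renameEquiv R (Equiv.swap i j) B = -B)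
    {l : σ →₀ ℕ} (hl : StrictMonoOn l V) [DecidablePred fun u : Finset σ =>
      unitExp u ≤ l ∧ StrictMonoOn (l - unitExp u : σ →₀ ℕ) (V : Set σ)] :
    ((∏ v ∈ S, (1 + MvPowerSeries.C (w v) * MvPowerSeries.X v)) * B).coeff l =
      ∑ u ∈ S.powerset.filter (fun u => unitExp u ≤ l ∧
          StrictMonoOn (l - unitExp u : σ →₀ ℕ) (V : Set σ)),
        (∏ v ∈ u, w v) * B.coeff (l - unitExp u) := by
  classical
  rw [coeff_prod_one_add_mul]
  symm
  refine Finset.sum_subset (fun u hu => ?_) fun u hu hu' => ?_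
  · rw [Finset.mem_filter] at hu ⊢
    exact ⟨hu.1, hu.2.1⟩
  rw [Finset.mem_filter, Finset.mem_powerset] at hu
  have hns : ¬ StrictMonoOn (l - unitExp u : σ →₀ ℕ) (V : Set σ) := fun h =>
    hu' (Finset.mem_filter.2 ⟨Finset.mem_powerset.2 hu.1, hu.2, h⟩)
  simp only [StrictMonoOn, not_forall] at hns
  obtain ⟨i, hi, j, hj, hij, h⟩ := hns
  have h1 := hl hi hj hij
  have h2 := hu.2 i
  have h3 := hu.2 j
  rw [unitExp_apply] at h2 h3
  simp only [Finsupp.tsub_apply, unitExp_apply] at h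
  have hju : j ∈ u := by
    by_contra hju
    rw [if_neg hju] at h
    omega
  rw [if_pos hju] at h
  -- Strictness can fail only if `j` moves, `i` does not, and `l j = l i + 1`. The new exponents of
  -- `i` and `j` then agree, and `hS` puts `i` among the variables in which `B` is antisymmetric.
  rw [coeff_eq_zero_of_renameEquiv_swap
    (hB i (hS i hi j (hu.1 hju) hij) j (hu.1 hju) hij.ne), mul_zero]
  simp only [Finsupp.tsub_apply, unitExp_apply, if_pos hju]
  omega

end Steps

/-! ### Iterating a one-step recursion. -/

section Sequences

variable {S α : Type*}

/-- The state reached after the first `r` moves of a sequence of moves. -/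
def stateAfter (next : S → α → S) (e : S) (U : ℕ → α) : ℕ → S
  | 0 => e
  | r + 1 => next (stateAfter next e U r) (U r)

theorem stateAfter_congr (next : S → α → S) (e : S) {U U' : ℕ → α} {r : ℕ}
    (h : ∀ s < r, U s = U' s) : stateAfter next e U r = stateAfter next e U' r := by
  induction r with
  | zero => rfl
  | succ r ih =>
    rw [stateAfter, stateAfter, ih fun s hs => h s (by omega), h r (by omega)]

theorem finite_setOf_eq_default [Finite α] [Inhabited α] (n : ℕ) :
    {U : ℕ → α | ∀ s, n ≤ s → U s = default}.Finite := by
  refine Set.Finite.of_injOn (f := fun U (i : Fin n) => U i) (t := Set.univ)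
    (fun _ _ => Set.mem_univ _) ?_ Set.finite_univ
  intro U hU U' hU' h
  funext s
  rcases lt_or_ge s n with hs | hs
  · exact congrFun h ⟨s, hs⟩
  · rw [hU s hs, hU' s hs]

/-- The sequences of `n` admissible moves from the state `e`. -/
noncomputable def moveSeqs [Finite α] [Inhabited α] (next : S → α → S) (e : S)
    (ok : ℕ → S → α → Prop) (n : ℕ) : Finset (ℕ → α) := open Classical in
  (finite_setOf_eq_default (α := α) n).toFinset.filter fun U =>
    ∀ s < n, ok s (stateAfter next e U s) (U s)

theorem mem_moveSeqs [Finite α] [Inhabited α] {next : S → α → S} {e : S}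
    {ok : ℕ → S → α → Prop} {n : ℕ} {U : ℕ → α} :
    U ∈ moveSeqs next e ok n ↔ (∀ s, n ≤ s → U s = default) ∧
      ∀ s < n, ok s (stateAfter next e U s) (U s) := by
  simp [moveSeqs]

/-- A function of the state that satisfies a one-step recursion is a weighted sum over the
sequences of moves. -/
theorem eq_sum_moveSeqs [Fintype α] [Inhabited α] {R : Type*} [CommSemiring R]
    (next : S → α → S) (e : S) (ok : ℕ → S → α → Prop) [∀ r l, DecidablePred (ok r l)]
    (w : ℕ → α → R) (φ : ℕ → S → R) (good : ℕ → S → Prop) (n : ℕ)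
    (hstep : ∀ r < n, ∀ l, good r l →
      φ r l = ∑ u with ok r l u, w r u * φ (r + 1) (next l u))
    (hgood : ∀ r l u, ok r l u → good (r + 1) (next l u)) (h0 : good 0 e) :
    ∀ t ≤ n, φ 0 e = ∑ U ∈ moveSeqs next e ok t,
      (∏ r ∈ Finset.range t, w r (U r)) * φ t (stateAfter next e U t) := by
  classical
  intro t ht
  induction t with
  | zero =>
    have : moveSeqs next e ok 0 = {fun _ => default} := by
      ext U
      simp [mem_moveSeqs, funext_iff]
    simp [this, stateAfter]
  | succ t ih =>
    rw [ih (by omega)]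
    have hst : ∀ U ∈ moveSeqs next e ok t, good t (stateAfter next e U t) := by
      intro U hU
      cases t with
      | zero => exact h0
      | succ t => exact hgood _ _ _ ((mem_moveSeqs.1 hU).2 t (by omega))
    rw [Finset.sum_congr rfl fun U hU => by
      rw [hstep t (by omega) _ (hst U hU), Finset.mul_sum], Finset.sum_sigma']
    -- A sequence of `t + 1` moves is a sequence of `t` moves with its default value at `t`
    -- overwritten; the inverse restores the default there.
    refine Finset.sum_bij' (fun p _ => Function.update p.1 t p.2)
      (fun U _ => ⟨Function.update U t default, U t⟩) ?_ ?_ ?_ ?_ ?_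
    · rintro ⟨U, u⟩ hp
      simp only [Finset.mem_sigma, Finset.mem_filter, Finset.mem_univ, true_and] at hp
      obtain ⟨hU, hu⟩ := hp
      rw [mem_moveSeqs] at hU ⊢
      have hc : ∀ s ≤ t, stateAfter next e (Function.update U t u) s = stateAfter next e U s :=
        fun s hs => stateAfter_congr _ _ fun s' hs' => Function.update_of_ne (by omega) _ _
      refine ⟨fun s hs => ?_, fun s hs => ?_⟩
      · rw [Function.update_of_ne (by omega)]
        exact hU.1 s (by omega)
      · rw [hc s (by omega)]
        rcases Nat.lt_succ_iff_lt_or_eq.1 hs with h | rfl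
        · rw [Function.update_of_ne (by omega)]
          exact hU.2 s h
        · rwa [Function.update_self]
    · intro U hU
      rw [mem_moveSeqs] at hU
      have hc : ∀ s ≤ t, stateAfter next e (Function.update U t default) s =
          stateAfter next e U s :=
        fun s hs => stateAfter_congr _ _ fun s' hs' => Function.update_of_ne (by omega) _ _
      simp only [Finset.mem_sigma, Finset.mem_filter, Finset.mem_univ, true_and]
      rw [mem_moveSeqs, hc t le_rfl]
      refine ⟨⟨fun s hs => ?_, fun s hs => ?_⟩, hU.2 t (by omega)⟩
      · rcases hs.eq_or_lt with rfl | h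
        · rw [Function.update_self]
        · rw [Function.update_of_ne (by omega)]
          exact hU.1 s (by omega)
      · rw [hc s hs.le, Function.update_of_ne (by omega)]
        exact hU.2 s (by omega)
    · rintro ⟨U, u⟩ hp
      simp only [Finset.mem_sigma] at hp
      have : U t = default := (mem_moveSeqs.1 hp.1).1 t le_rfl
      simp [← this]
    · intro U _
      simp
    · rintro ⟨U, u⟩ _
      rw [Finset.prod_range_succ, stateAfter, Function.update_self, mul_assoc,
        stateAfter_congr (U := Function.update U t u) (U' := U) _ _
          fun s' hs' => Function.update_of_ne (by omega) _ _]
      congr 1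
      refine Finset.prod_congr rfl fun s hs => ?_
      rw [Function.update_of_ne (Finset.mem_range.1 hs).ne]

end Sequences

/-! ### Path families as coefficients. -/

section Particles

variable {N : ℕ}

/-- The weight of a downward step of the path `v` between the times `s` and `s + 1`: the first
step of a path that starts late or just in time is marked. -/
noncomputable def stepWeight (m s : ℕ) (v : Fin N) : Polynomial ℤ :=
  if (v : ℕ) + 1 = m + s then Polynomial.X else 1

/-- The contribution of the steps of the path `v` between the times `a` and `b`. -/
noncomputable def stepSeries (m a b : ℕ) (v : Fin N) : MvPowerSeries (Fin N) (Polynomial ℤ) :=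
  ∏ s ∈ (Finset.Ico a b).filter (fun s => (v : ℕ) < m + s),
    (1 + MvPowerSeries.C (stepWeight m s v) * MvPowerSeries.X v)

theorem stepSeries_self (m a : ℕ) (v : Fin N) : stepSeries m a a v = 1 := by
  simp [stepSeries]

theorem stepSeries_mul (m : ℕ) {a b c : ℕ} (hab : a ≤ b) (hbc : b ≤ c) (v : Fin N) :
    stepSeries m a b v * stepSeries m b c v = stepSeries m a c v := by
  simp only [stepSeries, Finset.prod_filter]
  exact Finset.prod_Ico_consecutive _ hab hbc

theorem prod_stepSeries_eq_mul (m : ℕ) {a b : ℕ} (hab : a < b) (V : Finset (Fin N)) :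
    ∏ v ∈ V, stepSeries m a b v =
      (∏ v ∈ V.filter (fun v : Fin N => (v : ℕ) < m + a),
        (1 + MvPowerSeries.C (stepWeight m a v) * MvPowerSeries.X v)) *
      ∏ v ∈ V, stepSeries m (a + 1) b v := by
  rw [Finset.prod_filter, ← Finset.prod_mul_distrib]
  refine Finset.prod_congr rfl fun v _ => ?_
  rw [← stepSeries_mul m (Nat.le_succ a) hab v]
  congr 1
  simp [stepSeries, Finset.prod_filter]

/-- The strict bounds say that from time `a` on both paths are active and past their marked step, so
they have identical factors. -/
theorem renameEquiv_swap_stepSeries {m a : ℕ} (b : ℕ) {i j : Fin N} (hi : (i : ℕ) + 1 < m + a)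
    (hj : (j : ℕ) + 1 < m + a) (v : Fin N) :
    MvPowerSeries.renameEquiv (Polynomial ℤ) (Equiv.swap i j) (stepSeries m a b v) =
      stepSeries m a b (Equiv.swap i j v) := by
  have key : ∀ s ≥ a, ((v : ℕ) < m + s ↔ (Equiv.swap i j v : ℕ) < m + s) ∧
      (stepWeight m s v = stepWeight m s (Equiv.swap i j v)) := by
    intro s hs
    rw [Equiv.swap_apply_def]
    split_ifs with h1 h2
    · subst h1
      refine ⟨by omega, ?_⟩
      rw [stepWeight, stepWeight, if_neg (by omega), if_neg (by omega)]
    · subst h2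
      refine ⟨by omega, ?_⟩
      rw [stepWeight, stepWeight, if_neg (by omega), if_neg (by omega)]
    · exact ⟨Iff.rfl, rfl⟩
  rw [stepSeries, stepSeries, map_prod]
  refine Finset.prod_congr (Finset.filter_congr fun s hs => (key s ?_).1) fun s hs => ?_
  · exact (Finset.mem_Ico.1 hs).1
  · rw [map_add, map_mul, map_one, renameEquiv_C, renameEquiv_X,
      (key s (Finset.mem_Ico.1 (Finset.mem_filter.1 hs).1).1).2]

theorem renameEquiv_swap_prod_stepSeries {m a : ℕ} (b : ℕ) {i j : Fin N}
    (hi : (i : ℕ) + 1 < m + a) (hj : (j : ℕ) + 1 < m + a) (V : Finset (Fin N)) :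
    MvPowerSeries.renameEquiv (Polynomial ℤ) (Equiv.swap i j) (∏ v ∈ V, stepSeries m a b v) =
      ∏ v ∈ V.map (Equiv.swap i j).toEmbedding, stepSeries m a b v := by
  rw [map_prod, Finset.prod_map]
  exact Finset.prod_congr rfl fun v _ => renameEquiv_swap_stepSeries b hi hj v

theorem map_swap_eq_self {V : Finset (Fin N)} {i j : Fin N} (hi : i ∈ V) (hj : j ∈ V) :
    V.map (Equiv.swap i j).toEmbedding = V := by
  refine Finset.eq_of_subset_of_card_le (fun x hx => ?_) (Finset.card_map _).ge
  obtain ⟨y, hy, rfl⟩ := Finset.mem_map.1 hx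
  rw [Equiv.toEmbedding_apply, Equiv.swap_apply_def]
  split_ifs <;> assumption

theorem coeff_signSeries_of_strictMonoOn {V : Finset (Fin N)} {l : Fin N →₀ ℕ}
    (hl : StrictMonoOn l V) (h0 : ∀ i ∉ V, l i = 0) :
    (signSeries (Polynomial ℤ) V).coeff l = 1 := by
  rw [coeff_signSeries h0, pairProd, Finset.prod_eq_one, Int.cast_one]
  intro i hi
  refine Finset.prod_eq_one fun j hj => ?_
  rw [Finset.mem_filter] at hj
  have := hl hi hj.1 hj.2
  rw [Int.sign_eq_one_iff_pos]
  omega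

/-- The generating series of the paths from time `a` on, if the position of the first of them at
this time has to be `0`, as a sum over the variable which belongs to the first path. -/
noncomputable def cutSeries (N m a b : ℕ) : MvPowerSeries (Fin N) (Polynomial ℤ) :=
  ∑ i ∈ Finset.univ.filter (fun i : Fin N => (i : ℕ) + 1 < m + a),
    (-1) ^ (i : ℕ) * ((∏ v ∈ Finset.univ.erase i, stepSeries m a b v) *
      signSeries (Polynomial ℤ) (Finset.univ.erase i))

theorem card_filter_lt_erase (i j : Fin N) :
    ((Finset.univ.erase i).filter (fun v => v < j)).card + (if i < j then 1 else 0) = j := by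
  have h : (Finset.univ.filter (fun v : Fin N => v < j)).card = j := by
    rw [show Finset.univ.filter (fun v : Fin N => v < j) = Finset.Iio j by ext; simp, Fin.card_Iio]
  rw [Finset.filter_erase]
  split_ifs with hij
  · rw [Finset.card_erase_add_one (by simpa using hij), h]
  · rw [Finset.erase_eq_of_notMem (by simpa using hij), h, add_zero]

/-- The exchange permutes the summands. Those omitting neither variable change sign by themselves;
for the two that are interchanged, `(-1) ^ i` combines with the sign of
`renameEquiv_swap_signSeries_erase`. -/
theorem renameEquiv_swap_cutSeries {m a : ℕ} (b : ℕ) {i j : Fin N}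
    (hi : (i : ℕ) + 1 < m + a) (hj : (j : ℕ) + 1 < m + a) (hij : i ≠ j) :
    MvPowerSeries.renameEquiv (Polynomial ℤ) (Equiv.swap i j) (cutSeries N m a b) =
      -cutSeries N m a b := by
  rw [cutSeries, map_sum, ← Finset.sum_neg_distrib]
  have hmem : ∀ v : Fin N, (v : ℕ) + 1 < m + a → (Equiv.swap i j v : ℕ) + 1 < m + a := by
    intro v hv
    rw [Equiv.swap_apply_def]
    split_ifs <;> assumption
  have herase : ∀ v : Fin N, (Finset.univ.erase v).map (Equiv.swap i j).toEmbedding =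
      Finset.univ.erase (Equiv.swap i j v) := by
    intro v
    rw [Finset.map_erase, map_swap_eq_self (Finset.mem_univ _) (Finset.mem_univ _)]
    rfl
  refine Finset.sum_bij (fun v _ => Equiv.swap i j v) ?_ ?_ ?_ ?_
  · intro v hv
    simpa using hmem v (by simpa using hv)
  · intro _ _ _ _ h
    exact (Equiv.swap i j).injective h
  · intro v hv
    exact ⟨Equiv.swap i j v, by simpa using hmem v (by simpa using hv), by simp⟩
  intro v _
  rw [map_mul, map_mul, renameEquiv_swap_prod_stepSeries b hi hj, herase]
  simp only [map_pow, map_neg, map_one]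
  have hsign : ∀ x y : Fin N, x ≠ y →
      ((-1 : MvPowerSeries (Fin N) (Polynomial ℤ)) ^ (x : ℕ)) *
        (-1) ^ (((Finset.univ.erase x).filter (fun v => v < y)).card +
          ((Finset.univ.erase y).filter (fun v => v < x)).card) = -(-1) ^ (y : ℕ) := by
    intro x y hxy
    have h1 := card_filter_lt_erase x y
    have h2 := card_filter_lt_erase y x
    rw [← pow_add, ← mul_neg_one ((-1) ^ (y : ℕ)), ← pow_succ]
    refine neg_one_pow_congr ?_
    rcases hxy.lt_or_gt with h | h
    · rw [if_pos h] at h1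
      rw [if_neg h.not_gt] at h2
      simp only [Nat.even_iff]
      omega
    · rw [if_neg h.not_gt] at h1
      rw [if_pos h] at h2
      simp only [Nat.even_iff]
      omega
  by_cases hvi : v = i
  · subst hvi
    rw [Equiv.swap_apply_left, renameEquiv_swap_signSeries_erase hij]
    linear_combination ((∏ v ∈ Finset.univ.erase j, stepSeries m a b v) *
      signSeries (Polynomial ℤ) (Finset.univ.erase j)) * hsign v j hij
  by_cases hvj : v = j
  · subst hvj
    rw [Equiv.swap_apply_right, Equiv.swap_comm, renameEquiv_swap_signSeries_erase hij.symm]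
    linear_combination ((∏ v ∈ Finset.univ.erase i, stepSeries m a b v) *
      signSeries (Polynomial ℤ) (Finset.univ.erase i)) * hsign v i hij.symm
  rw [Equiv.swap_apply_of_ne_of_ne hvi hvj, renameEquiv_swap_signSeries (by simp [Ne.symm hvi])
    (by simp [Ne.symm hvj]) hij]
  ring

/-- The power series in which the variable `x_i` does not occur. -/
def seriesWithout (σ R : Type*) [CommRing R] (i : σ) : Subring (MvPowerSeries σ R) where
  carrier := {B | ∀ l : σ →₀ ℕ, l i ≠ 0 → B.coeff l = 0}
  zero_mem' := fun l _ => map_zero _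
  one_mem' := by
    classical
    intro l hl
    rw [MvPowerSeries.coeff_one, if_neg]
    rintro rfl
    exact hl rfl
  add_mem' := fun {A B} hA hB l hl => by rw [map_add, hA l hl, hB l hl, add_zero]
  neg_mem' := fun {A} hA l hl => by rw [map_neg, hA l hl, neg_zero]
  mul_mem' := fun {A B} hA hB l hl => by
    classical
    rw [MvPowerSeries.coeff_mul]
    refine Finset.sum_eq_zero fun p hp => ?_
    rw [Finset.HasAntidiagonal.mem_antidiagonal] at hp
    by_cases h : p.1 i = 0
    · rw [hB p.2, mul_zero]
      intro h'
      exact hl (by rw [← hp, Finsupp.add_apply, h, h'])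
    · rw [hA p.1 h, zero_mul]

theorem stepSeries_mem_seriesWithout (m a b : ℕ) {i v : Fin N} (h : v ≠ i) :
    stepSeries m a b v ∈ seriesWithout (Fin N) (Polynomial ℤ) i := by
  refine Subring.prod_mem _ fun s _ => Subring.add_mem _ (Subring.one_mem _) ?_
  intro l hl
  rw [MvPowerSeries.coeff_C_mul, MvPowerSeries.coeff_X, if_neg, mul_zero]
  rintro rfl
  exact hl (by simp [h])

/-- The summand of `i` does not contain `x_i`, so it contributes only if `l i = 0`. For strictly
increasing `l` this is possible only at the first index. -/
theorem coeff_cutSeries {m a b : ℕ} {z : Fin N} (hz : (z : ℕ) = 0) (hma : 1 < m + a)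
    {l : Fin N →₀ ℕ} (hl : StrictMono l) :
    (cutSeries N m a b).coeff l = if l z = 0 then
      ((∏ v ∈ Finset.univ.erase z, stepSeries m a b v) *
        signSeries (Polynomial ℤ) (Finset.univ.erase z)).coeff l else 0 := by
  have hvan : ∀ i : Fin N, l i ≠ 0 → ((∏ v ∈ Finset.univ.erase i, stepSeries m a b v) *
        signSeries (Polynomial ℤ) (Finset.univ.erase i)).coeff l = 0 := by
    intro i hi
    have : (∏ v ∈ Finset.univ.erase i, stepSeries m a b v) *
        signSeries (Polynomial ℤ) (Finset.univ.erase i) ∈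
          seriesWithout (Fin N) (Polynomial ℤ) i := by
      refine Subring.mul_mem _ (Subring.prod_mem _ fun v hv =>
        stepSeries_mem_seriesWithout m a b (Finset.ne_of_mem_erase hv)) ?_
      intro l hl
      exact coeff_signSeries_eq_zero (i := i) (by simp) hl
    exact this l hi
  have hC : ∀ p : ℕ, ((-1 : MvPowerSeries (Fin N) (Polynomial ℤ)) ^ p) =
      MvPowerSeries.C ((-1) ^ p) := fun p => by simp
  rw [cutSeries, map_sum, Finset.sum_eq_single z]
  · rw [hz, pow_zero, one_mul]
    split_ifs with h
    · rfl
    · exact hvan z h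
  · intro i _ hi
    rw [hC, MvPowerSeries.coeff_C_mul, hvan, mul_zero]
    have : z < i := by
      rw [Fin.lt_def]
      have := fun h => hi (Fin.ext h)
      omega
    have := hl this
    omega
  · intro h
    exact absurd (by simp; omega) h

/-- The admissible positions at time `r` of the paths: strictly increasing, the first path being
frozen at the position `0` from time `a` on if `a < n`. -/
def PathState (n a r : ℕ) (l : Fin N →₀ ℕ) : Prop :=
  StrictMonoOn l {v : Fin N | (v : ℕ) ≠ 0 ∨ r ≤ a} ∧
    (a ≤ r → a < n → ∀ v : Fin N, (v : ℕ) = 0 → l v = 0)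

/-- The paths in `u` can go down between the times `r` and `r + 1`. -/
def PathMove (m n a r : ℕ) (l : Fin N →₀ ℕ) (u : Finset (Fin N)) : Prop :=
  (∀ v ∈ u, (v : ℕ) < m + r ∧ ((v : ℕ) ≠ 0 ∨ r < a)) ∧ unitExp u ≤ l ∧
    PathState n a (r + 1) (l - unitExp u)

/-- The weighted number of path families which start at the positions `e`. -/
noncomputable def pathSum (m n a : ℕ) (e : Fin N →₀ ℕ) : Polynomial ℤ :=
  ∑ U ∈ moveSeqs (fun l u => l - unitExp u) e (PathMove m n a) n,
    ∏ r ∈ Finset.range n, ∏ v ∈ U r, stepWeight m r v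

theorem moveSeqs_state [Finite (Finset (Fin N))] {m n a : ℕ} {e : Fin N →₀ ℕ}
    (he : PathState n a 0 e) {t : ℕ} {U : ℕ → Finset (Fin N)}
    (hU : U ∈ moveSeqs (fun l u => l - unitExp u) e (PathMove m n a) t) {r : ℕ} (hr : r ≤ t) :
    PathState n a r (stateAfter (fun l u => l - unitExp u) e U r) := by
  cases r with
  | zero => exact he
  | succ r => exact ((mem_moveSeqs.1 hU).2 r hr).2.2

/-- Time steps are peeled off until `signSeries` alone remains, whose coefficient at a strictly
increasing exponent is `1`. Cut time `n` means that no path is frozen. -/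
theorem coeff_prod_stepSeries_mul_signSeries (m n : ℕ) {e : Fin N →₀ ℕ} (he : StrictMono e) :
    ((∏ v, stepSeries m 0 n v) * signSeries (Polynomial ℤ) Finset.univ).coeff e =
      pathSum m n n e := by
  classical
  have hstate : PathState n n 0 e := ⟨he.strictMonoOn _, fun _ h => absurd h (lt_irrefl _)⟩
  have key := eq_sum_moveSeqs (fun l u => l - unitExp u) e (PathMove m n n)
    (fun r u => ∏ v ∈ u, stepWeight m r v)
    (fun r l => ((∏ v, stepSeries m r n v) *
      signSeries (Polynomial ℤ) Finset.univ).coeff l) (PathState n n) n ?_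
    (fun r l u h => h.2.2) hstate n le_rfl
  · rw [key, pathSum]
    refine Finset.sum_congr rfl fun U hU => ?_
    have h := moveSeqs_state hstate hU le_rfl
    simp only [stepSeries_self, Finset.prod_const_one, one_mul]
    rw [coeff_signSeries_of_strictMonoOn, mul_one]
    · exact h.1.mono fun v _ => Or.inr le_rfl
    · simp
  · intro r hr l hl
    rw [prod_stepSeries_eq_mul m hr, mul_assoc,
      coeff_prod_one_add_mul_of_strictMonoOn (V := Finset.univ)]
    · refine Finset.sum_congr ?_ fun _ _ => rfl
      ext u
      simp only [Finset.mem_filter, Finset.mem_powerset, Finset.mem_univ, true_and, PathMove,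
        PathState, Finset.subset_iff, hr, or_true, and_true, Finset.coe_univ, lt_irrefl,
        false_imp_iff, imp_true_iff, show r + 1 ≤ n from hr, Set.ofPred_true]
    · intro i _ j hj hij
      simp only [Finset.mem_filter, Finset.mem_univ, true_and] at hj ⊢
      exact lt_trans hij hj
    · intro i hi j hj hij
      simp only [Finset.mem_filter, Finset.mem_univ, true_and] at hi hj
      rw [map_mul, renameEquiv_swap_prod_stepSeries n (by omega) (by omega),
        map_swap_eq_self (Finset.mem_univ _) (Finset.mem_univ _),
        renameEquiv_swap_signSeries (Finset.mem_univ _) (Finset.mem_univ _) hij, mul_neg]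
    · exact hl.1.mono fun v _ => Or.inr hr.le

theorem coeff_prod_stepSeries_mul_cutSeries {m n a : ℕ} (han : a < n) (hma : 1 < m + a)
    {z : Fin N} (hz : (z : ℕ) = 0) {e : Fin N →₀ ℕ} (he : StrictMono e)
    (he0 : a = 0 → e z = 0) :
    ((∏ v, stepSeries m 0 a v) * cutSeries N m a n).coeff e = pathSum m n a e := by
  classical
  have hz' : ∀ v : Fin N, (v : ℕ) = 0 ↔ v = z := fun v => by rw [Fin.ext_iff, hz]
  have hstate : PathState n a 0 e := ⟨he.strictMonoOn _, fun h _ v hv => by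
    rw [(hz' v).1 hv]; exact he0 (by omega)⟩
  -- Before time `a` all paths move and `cutSeries` stands for the future; from time `a` on the
  -- first variable has disappeared. `coeff_cutSeries` joins the two regimes.
  set φ : ℕ → (Fin N →₀ ℕ) → Polynomial ℤ := fun r l =>
    if r < a then ((∏ v, stepSeries m r a v) * cutSeries N m a n).coeff l
    else ((∏ v ∈ Finset.univ.erase z, stepSeries m r n v) *
      signSeries (Polynomial ℤ) (Finset.univ.erase z)).coeff l with hφ
  have key := eq_sum_moveSeqs (fun l u => l - unitExp u) e (PathMove m n a)
    (fun r u => ∏ v ∈ u, stepWeight m r v) φ (PathState n a) n ?_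
    (fun r l u h => h.2.2) hstate n le_rfl
  · have h0 : ((∏ v, stepSeries m 0 a v) * cutSeries N m a n).coeff e = φ 0 e := by
      simp only [hφ]
      split_ifs with h
      · rfl
      · obtain rfl : a = 0 := by omega
        simp only [stepSeries_self, Finset.prod_const_one, one_mul]
        rw [coeff_cutSeries hz hma he, if_pos (he0 rfl)]
    rw [h0, key, pathSum]
    refine Finset.sum_congr rfl fun U hU => ?_
    have h := moveSeqs_state hstate hU le_rfl
    simp only [hφ]
    simp only [if_neg han.not_gt, stepSeries_self, Finset.prod_const_one, one_mul]
    rw [coeff_signSeries_of_strictMonoOn, mul_one]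
    · refine h.1.mono fun v hv => Or.inl ?_
      rw [Ne, hz']
      simpa using hv
    · intro i hi
      exact h.2 han.le han i ((hz' i).2 (by simpa using hi))
  · intro r hr l hl
    simp only [hφ]
    rcases lt_or_ge r a with hra | hra
    · have hstep : ((∏ v, stepSeries m r a v) * cutSeries N m a n).coeff l =
          ∑ u ∈ (Finset.univ.filter (fun v : Fin N => (v : ℕ) < m + r)).powerset.filter
            (fun u => unitExp u ≤ l ∧
              StrictMonoOn (l - unitExp u : Fin N →₀ ℕ) ((Finset.univ : Finset (Fin N)) : Set _)),
          (∏ v ∈ u, stepWeight m r v) *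
            ((∏ v, stepSeries m (r + 1) a v) * cutSeries N m a n).coeff (l - unitExp u) := by
        rw [prod_stepSeries_eq_mul m hra, mul_assoc,
          coeff_prod_one_add_mul_of_strictMonoOn (V := Finset.univ)]
        · intro i _ j hj hij
          simp only [Finset.mem_filter, Finset.mem_univ, true_and] at hj ⊢
          exact lt_trans hij hj
        · intro i hi j hj hij
          simp only [Finset.mem_filter, Finset.mem_univ, true_and] at hi hj
          rw [map_mul, renameEquiv_swap_prod_stepSeries a (by omega) (by omega),
            map_swap_eq_self (Finset.mem_univ _) (Finset.mem_univ _),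
            renameEquiv_swap_cutSeries n (by omega) (by omega) hij, mul_neg]
        · exact hl.1.mono fun v _ => Or.inr hra.le
      rw [if_pos hra, hstep]
      rcases Nat.lt_or_ge (r + 1) a with hra' | hra'
      · simp only [if_pos hra']
        refine Finset.sum_congr ?_ fun _ _ => rfl
        ext u
        simp only [Finset.mem_filter, Finset.mem_powerset, Finset.mem_univ, true_and, PathMove,
          PathState, Finset.subset_iff, hra, or_true, and_true, Finset.coe_univ, hra'.not_ge,
          false_imp_iff, hra'.le, Set.ofPred_true]
      -- At the last step before the cut, evaluating `cutSeries` at the new exponent imposes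
      -- position `0` on the first path, which is the additional clause of `PathState`.
      · obtain rfl : a = r + 1 := by omega
        simp only [lt_irrefl, if_false, stepSeries_self, Finset.prod_const_one, one_mul]
        have hfil : Finset.univ.filter (PathMove m n (r + 1) r l) =
            ((Finset.univ.filter (fun v : Fin N => (v : ℕ) < m + r)).powerset.filter
              (fun u => unitExp u ≤ l ∧ StrictMonoOn (l - unitExp u : Fin N →₀ ℕ)
                ((Finset.univ : Finset (Fin N)) : Set _))).filter
              fun u => (l - unitExp u) z = 0 := by
          ext u
          simp only [Finset.mem_filter, Finset.mem_powerset, Finset.mem_univ, true_and, PathMove,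
            PathState, Finset.subset_iff, hra, or_true, and_true, Finset.coe_univ, le_refl,
            true_imp_iff, Set.ofPred_true, han, hz', forall_eq]
          tauto
        rw [hfil, Finset.sum_filter (fun u : Finset (Fin N) => (l - unitExp u) z = 0)]
        refine Finset.sum_congr rfl fun u hu => ?_
        rw [Finset.mem_filter, Finset.coe_univ, strictMonoOn_univ] at hu
        rw [coeff_cutSeries hz hma hu.2.2, mul_ite, mul_zero]
    · rw [if_neg hra.not_gt]
      simp only [if_neg (show ¬ r + 1 < a by omega)]
      rw [prod_stepSeries_eq_mul m hr, mul_assoc,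
        coeff_prod_one_add_mul_of_strictMonoOn (V := Finset.univ.erase z)]
      · refine Finset.sum_congr ?_ fun _ _ => rfl
        ext u
        have hlz := hl.2 hra han z hz
        have hset : {v : Fin N | ¬ v = z ∨ r + 1 ≤ a} =
            ((Finset.univ.erase z : Finset (Fin N)) : Set (Fin N)) := by
          ext v
          simp [show ¬ r + 1 ≤ a by omega]
        simp only [Finset.mem_filter, Finset.mem_powerset, Finset.mem_univ, true_and, PathMove,
          PathState, Finset.subset_iff, hra.not_gt, or_false, hset, han, hz',
          forall_eq, Finset.mem_erase, and_true, Finsupp.tsub_apply, hlz, Nat.zero_sub,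
          imp_true_iff, Ne]
        exact and_congr_left fun _ => forall_congr' fun v => imp_congr_right fun _ => and_comm
      · intro i hi j hj hij
        simp only [Finset.mem_filter] at hj ⊢
        exact ⟨hi, lt_trans hij hj.2⟩
      · intro i hi j hj hij
        simp only [Finset.mem_filter] at hi hj
        rw [map_mul, renameEquiv_swap_prod_stepSeries n (by omega) (by omega),
          map_swap_eq_self hi.1 hj.1, renameEquiv_swap_signSeries hi.1 hj.1 hij, mul_neg]
      · refine hl.1.mono fun v hv => Or.inl ?_
        rw [Ne, hz']
        simpa using hv

end Particles

/-! ### Heights of a trapezoid. -/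

/-- A downward closed subset of `Icc 1 K` is an initial segment, so its cardinality is its largest
element. -/
theorem le_card_filter_Icc_iff {K : ℕ} {p : ℕ → Prop} [DecidablePred p]
    (hp : ∀ d, 1 ≤ d → d + 1 ≤ K → p (d + 1) → p d) {d : ℕ} (h1 : 1 ≤ d) (hK : d ≤ K) :
    d ≤ ((Finset.Icc 1 K).filter p).card ↔ p d := by
  have hdown : ∀ b c, 1 ≤ c → c + b ≤ K → p (c + b) → p c := by
    intro b
    induction b with
    | zero => exact fun c _ _ h => h
    | succ b ih => exact fun c hc hb h => ih c hc (by omega) (hp _ (by omega) hb h)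
  constructor
  · intro h
    by_contra hnp
    have hsub : (Finset.Icc 1 K).filter p ⊆ Finset.Icc 1 (d - 1) := by
      intro c hc
      rw [Finset.mem_filter, Finset.mem_Icc] at hc
      rw [Finset.mem_Icc]
      refine ⟨hc.1.1, ?_⟩
      by_contra hcd
      refine hnp (hdown (c - d) d h1 (by omega) ?_)
      rw [show d + (c - d) = c by omega]
      exact hc.2
    have := Finset.card_le_card hsub
    rw [Nat.card_Icc] at this
    omega
  · intro h
    have hsub : Finset.Icc 1 d ⊆ (Finset.Icc 1 K).filter p := by
      intro c hc
      rw [Finset.mem_Icc] at hc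
      rw [Finset.mem_filter, Finset.mem_Icc]
      refine ⟨⟨hc.1, hc.2.trans hK⟩, hdown (d - c) c hc.1 (by omega) ?_⟩
      rwa [show c + (d - c) = d by omega]
    have := Finset.card_le_card hsub
    rw [Nat.card_Icc] at this
    omega

namespace MagogTrapezoid

variable {m n k : ℕ} (T : MagogTrapezoid m n k)

/-- The height at time `r` of the path that separates the entries at most `v` from the larger
ones. -/
def height (r v : ℕ) : ℕ :=
  ((Finset.Icc 1 k).filter fun d => T.entry d (d + r - k) ≤ v).card

theorem entry_le_entry_succ_left {d i : ℕ} (hd : 1 ≤ d) (hd' : d + 1 ≤ k) (hi : i + k ≤ n + d + 1) :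
    T.entry d i ≤ T.entry (d + 1) i := by
  by_cases h : MagogCell n k d i
  · exact T.mono_ne d i h ⟨by omega, hd', h.2.2.1, hi⟩
  · rw [T.outside d i h]
    exact Nat.zero_le _

theorem entry_le_entry_succ_right {d i : ℕ} (hd : 1 ≤ d) (hd' : d ≤ k) (hi : i + 1 + k ≤ n + d) :
    T.entry d i ≤ T.entry d (i + 1) := by
  by_cases h : MagogCell n k d i
  · exact T.mono_se d i h ⟨hd, hd', by omega, hi⟩
  · rw [T.outside d i h]
    exact Nat.zero_le _

theorem entry_zero (d : ℕ) : T.entry d 0 = 0 :=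
  T.outside d 0 fun h => absurd h.2.2.1 (by omega)

/-- Rows increase from left to right, by one NE and one SE comparison. Truncated subtraction sends
missing cells at the left to index `0`, where the entry is `0`, so short rows are padded
consistently. -/
theorem le_height_iff {r v d : ℕ} (hr : r ≤ n) (hd : 1 ≤ d) (hdk : d ≤ k) :
    d ≤ T.height r v ↔ T.entry d (d + r - k) ≤ v := by
  refine le_card_filter_Icc_iff (p := fun d => T.entry d (d + r - k) ≤ v) ?_ hd hdk
  intro d hd hdk h
  refine le_trans ?_ h
  rcases le_or_gt (d + r) k with hk | hk
  · rw [show d + r - k = 0 by omega, T.entry_zero]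
    exact Nat.zero_le _
  · refine (T.entry_le_entry_succ_left hd hdk (by omega)).trans ?_
    rw [show d + 1 + r - k = d + r - k + 1 by omega]
    exact T.entry_le_entry_succ_right (by omega) hdk (by omega)

theorem height_le (r v : ℕ) : T.height r v ≤ k := by
  refine (Finset.card_filter_le _ _).trans ?_
  rw [Nat.card_Icc]
  omega

theorem height_eq (hk : 1 ≤ k) {r v : ℕ} (hr : r ≤ n) (hv : m + r ≤ v) : T.height r v = k := by
  refine le_antisymm (T.height_le r v) ((T.le_height_iff hr hk le_rfl).2 ?_)
  rw [show k + r - k = r by omega]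
  by_cases h : MagogCell n k k r
  · exact (T.le_bound k r h).trans hv
  · rw [T.outside k r h]
    exact Nat.zero_le _

theorem height_succ_le {r : ℕ} (v : ℕ) (hr : r + 1 ≤ n) : T.height (r + 1) v ≤ T.height r v := by
  rcases Nat.eq_zero_or_pos (T.height (r + 1) v) with h | h
  · omega
  have hk := T.height_le (r + 1) v
  rw [T.le_height_iff (by omega) h hk]
  refine le_trans ?_ ((T.le_height_iff hr h hk).1 le_rfl)
  generalize T.height (r + 1) v = d at *
  rcases le_or_gt (d + r) k with hd | hd
  · rw [show d + r - k = 0 by omega, T.entry_zero]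
    exact Nat.zero_le _
  · rw [show d + (r + 1) - k = d + r - k + 1 by omega]
    exact T.entry_le_entry_succ_right h hk (by omega)

/-- If entry `c + 1` of row `r` is at most `v`, so is its left neighbour on the same NE-diagonal,
which is entry `c` of row `r + 1`. -/
theorem height_le_succ {r : ℕ} (v : ℕ) (hr : r + 1 ≤ n) :
    T.height r v ≤ T.height (r + 1) v + 1 := by
  rcases lt_or_ge (T.height r v) 2 with h | h
  · omega
  have hk := T.height_le r v
  have h1 := (T.le_height_iff (by omega) (by omega) hk).1 (le_refl (T.height r v))
  generalize T.height r v = d at *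
  obtain ⟨c, rfl⟩ : ∃ c, d = c + 1 := ⟨d - 1, by omega⟩
  rw [Nat.add_le_add_iff_right, T.le_height_iff hr (by omega) (by omega)]
  refine le_trans ?_ h1
  rw [show c + (r + 1) - k = c + 1 + r - k by omega]
  rcases le_or_gt (c + 1 + r) k with hc | hc
  · rw [show c + 1 + r - k = 0 by omega, T.entry_zero]
    exact Nat.zero_le _
  · exact T.entry_le_entry_succ_left (by omega) hk (by omega)

theorem height_zero (hk : 1 ≤ k) (v : ℕ) : T.height 0 v = k := by
  refine le_antisymm (T.height_le 0 v) ((T.le_height_iff (Nat.zero_le n) hk le_rfl).2 ?_)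
  rw [show k + 0 - k = 0 by omega, T.entry_zero]
  exact Nat.zero_le _

theorem height_mono (r : ℕ) {v v' : ℕ} (h : v ≤ v') : T.height r v ≤ T.height r v' :=
  Finset.card_le_card fun d hd => by
    rw [Finset.mem_filter] at hd ⊢
    exact ⟨hd.1, hd.2.trans h⟩

theorem height_antitone {r s : ℕ} (v : ℕ) (hrs : r ≤ s) (hs : s ≤ n) :
    T.height s v ≤ T.height r v := by
  induction s, hrs using Nat.le_induction with
  | base => exact le_rfl
  | succ s hrs ih => exact (T.height_succ_le v hs).trans (ih (by omega))

/-- The entry `a_{1,i}` comes first in row `k + i - 1`, so it is `1` exactly when the height there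
for threshold `1` is positive. The minima form an initial segment of the diagonal. -/
theorem numMinima_eq_iff (hk : 1 ≤ k) (hkn : k ≤ n) {q : ℕ} (hq : q ≤ n - k + 1) :
    T.numMinima = q ↔
      1 ≤ T.height (k + q - 1) 1 ∧ (k + q - 1 < n → T.height (k + q - 1 + 1) 1 = 0) := by
  have hiff : ∀ i, 1 ≤ i → i ≤ n + 1 - k → (i ≤ T.numMinima ↔ 1 ≤ T.height (k + i - 1) 1) := by
    intro i hi hi'
    have hpos := fun i (h1 : 1 ≤ i) (h2 : i ≤ n + 1 - k) =>
      T.pos 1 i ⟨le_rfl, hk, h1, by omega⟩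
    rw [T.le_height_iff (by omega) le_rfl hk, show 1 + (k + i - 1) - k = i by omega]
    refine (le_card_filter_Icc_iff (p := fun i => T.entry 1 i = 1) ?_ hi hi').trans ?_
    · intro i h1 h2 h3
      have := hpos i h1 (by omega)
      have := T.entry_le_entry_succ_right (d := 1) (i := i) le_rfl hk (by omega)
      omega
    · have := hpos i hi hi'
      omega
  have hle : T.numMinima ≤ n + 1 - k := by
    refine (Finset.card_filter_le _ _).trans ?_
    rw [Nat.card_Icc]
    omega
  have h1 : 1 ≤ T.height (k + q - 1) 1 ↔ q ≤ T.numMinima := by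
    rcases Nat.eq_zero_or_pos q with rfl | h
    · rw [T.le_height_iff (by omega) le_rfl hk, show 1 + (k + 0 - 1) - k = 0 by omega,
        T.entry_zero]
      simp
    · rw [hiff q h (by omega)]
  rw [h1]
  rcases lt_or_ge (k + q - 1) n with h | h
  · have h2 := hiff (q + 1) (by omega) (by omega)
    rw [show k + (q + 1) - 1 = k + q - 1 + 1 by omega] at h2
    constructor
    · rintro rfl
      exact ⟨le_rfl, fun _ => by omega⟩
    · rintro ⟨h3, h4⟩
      have := h4 h
      omega
  · constructor
    · rintro rfl
      exact ⟨le_rfl, fun h' => absurd h' (by omega)⟩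
    · rintro ⟨h3, _⟩
      omega

/-- Entries lie between `1` and `m + n`, so the thresholds up to `m + n - 1` distinguish them. -/
theorem ext_height {T T' : MagogTrapezoid m n k}
    (h : ∀ r ≤ n, ∀ v, 1 ≤ v → v ≤ m + n - 1 → T.height r v = T'.height r v) : T = T' := by
  ext d i
  by_cases hc : MagogCell n k d i
  swap
  · rw [T.outside d i hc, T'.outside d i hc]
  obtain ⟨hd, hdk, hi, hin⟩ := id hc
  have key : ∀ v, 1 ≤ v → v ≤ m + n - 1 → (T.entry d i ≤ v ↔ T'.entry d i ≤ v) := by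
    intro v hv hv'
    have h1 := T.le_height_iff (r := i + k - d) (v := v) (by omega) hd hdk
    have h2 := T'.le_height_iff (r := i + k - d) (v := v) (by omega) hd hdk
    rw [show d + (i + k - d) - k = i by omega] at h1 h2
    rw [← h1, ← h2, h _ (by omega) v hv hv']
  have h1 := T.pos d i hc
  have h2 := T'.pos d i hc
  have h3 := T.le_bound d i hc
  have h4 := T'.le_bound d i hc
  rcases lt_trichotomy (T.entry d i) (T'.entry d i) with h | h | h
  · have := (key _ h1 (by omega)).1 le_rfl
    omega
  · exact h
  · have := (key _ h2 (by omega)).2 le_rfl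
    omega

theorem exists_height_eq (h : ℕ → ℕ → ℕ) (hzero : ∀ v, 1 ≤ v → h 0 v = k)
    (hmono : ∀ r ≤ n, ∀ v v', 1 ≤ v → v ≤ v' → h r v ≤ h r v')
    (htop : ∀ r ≤ n, ∀ v, 1 ≤ v → m + r ≤ v → h r v = k)
    (hstep : ∀ r < n, ∀ v, 1 ≤ v → h (r + 1) v ≤ h r v ∧ h r v ≤ h (r + 1) v + 1) :
    ∃ T : MagogTrapezoid m n k, ∀ r ≤ n, ∀ v, 1 ≤ v → T.height r v = h r v := by
  classical
  have hle : ∀ r ≤ n, ∀ v, 1 ≤ v → h r v ≤ k := by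
    intro r hr v hv
    rw [← htop r hr (v + m + r) (by omega) (by omega)]
    exact hmono r hr v _ hv (by omega)
  have hdrop : ∀ b r, r + b ≤ n → ∀ v, 1 ≤ v → h r v ≤ h (r + b) v + b := by
    intro b
    induction b with
    | zero => exact fun r _ v _ => le_rfl
    | succ b ih =>
      intro r hr v hv
      have h1 := ih r (by omega) v hv
      have h2 := (hstep (r + b) (by omega) v hv).2
      rw [show r + (b + 1) = r + b + 1 by omega]
      omega
  -- The entry is the least positive threshold at which the height of its row reaches `d`; by `htop`
  -- it is enough to inspect thresholds up to `m + n`.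
  let f : ℕ → ℕ → ℕ := fun d i => if MagogCell n k d i then
    1 + ((Finset.Icc 1 (m + n)).filter fun v => h (i + k - d) v < d).card else 0
  have hf : ∀ d i, MagogCell n k d i → ∀ v, 1 ≤ v → (f d i ≤ v ↔ d ≤ h (i + k - d) v) := by
    intro d i hc v hv
    obtain ⟨hd, hdk, hi, hin⟩ := id hc
    simp only [f, if_pos hc]
    constructor
    · intro hcard
      by_contra hlt
      have hvmn : v ≤ m + n := by
        by_contra hvmn
        exact hlt (by rw [htop _ (by omega) v hv (by omega)]; exact hdk)
      have hsub : Finset.Icc 1 v ⊆ (Finset.Icc 1 (m + n)).filter fun v => h (i + k - d) v < d := by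
        intro v' hv'
        rw [Finset.mem_Icc] at hv'
        rw [Finset.mem_filter, Finset.mem_Icc]
        have := hmono (i + k - d) (by omega) v' v hv'.1 hv'.2
        omega
      have := Finset.card_le_card hsub
      rw [Nat.card_Icc] at this
      omega
    · intro hle
      have hsub : ((Finset.Icc 1 (m + n)).filter fun v => h (i + k - d) v < d) ⊆
          Finset.Icc 1 (v - 1) := by
        intro v' hv'
        rw [Finset.mem_filter, Finset.mem_Icc] at hv'
        rw [Finset.mem_Icc]
        by_contra hcon
        have := hmono (i + k - d) (by omega) v v' hv (by omega)
        omega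
      have := Finset.card_le_card hsub
      rw [Nat.card_Icc] at this
      omega
  have hpos : ∀ d i, MagogCell n k d i → 1 ≤ f d i := fun d i hc => by
    simp only [f, if_pos hc]
    omega
  let T : MagogTrapezoid m n k :=
    { entry := f
      outside := fun d i hc => if_neg hc
      pos := hpos
      le_bound := fun d i hc => by
        obtain ⟨hd, hdk, hi, hin⟩ := id hc
        rw [hf d i hc _ (by omega)]
        -- In row `i` the height for `m + i` is still `k`; after `k - d` further rows, each losing
        -- at most one, it is at least `d`.
        have h1 := hdrop (k - d) i (by omega) (m + i) (by omega)
        rw [htop i (by omega) (m + i) (by omega) le_rfl,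
          show i + (k - d) = i + k - d by omega] at h1
        omega
      mono_ne := fun d i hc hc' => by
        obtain ⟨hd, hdk, hi, hin⟩ := id hc
        have h1 := (hf (d + 1) i hc' _ (hpos _ _ hc')).1 le_rfl
        rw [hf d i hc _ (hpos _ _ hc')]
        have h2 := (hstep (i + k - (d + 1)) (by omega) _ (hpos _ _ hc')).2
        rw [show i + k - (d + 1) + 1 = i + k - d by have := hc'.2.1; omega] at h2
        omega
      mono_se := fun d i hc hc' => by
        obtain ⟨hd, hdk, hi, hin⟩ := id hc
        have hin' := hc'.2.2.2
        have h1 := (hf d (i + 1) hc' _ (hpos _ _ hc')).1 le_rfl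
        rw [hf d i hc _ (hpos _ _ hc')]
        have h2 := (hstep (i + k - d) (by omega) _ (hpos _ _ hc')).1
        rw [show i + k - d + 1 = i + 1 + k - d by omega] at h2
        omega }
  refine ⟨T, fun r hr v hv => ?_⟩
  have key : ∀ d, 1 ≤ d → d ≤ k → (d ≤ T.height r v ↔ d ≤ h r v) := by
    intro d hd hdk
    rw [T.le_height_iff hr hd hdk]
    rcases le_or_gt (d + r) k with hdr | hdr
    · rw [show d + r - k = 0 by omega, T.entry_zero]
      have h1 := hdrop r 0 (by omega) v hv
      rw [hzero v hv, Nat.zero_add] at h1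
      simp only [Nat.zero_le, true_iff]
      omega
    · have := hf d (d + r - k) ⟨hd, hdk, by omega, by omega⟩ v hv
      rw [show d + r - k + k - d = r by omega] at this
      exact this
  have h1 := T.height_le r v
  have h2 := hle r hr v hv
  rcases lt_trichotomy (T.height r v) (h r v) with h3 | h3 | h3
  · have := (key (h r v) (by omega) h2).2 le_rfl
    omega
  · exact h3
  · have := (key (T.height r v) (by omega) h1).1 le_rfl
    omega

end MagogTrapezoid

/-! ### The bijection between trapezoids and path families. -/

namespace MagogTrapezoid

variable {m n k : ℕ} (T : MagogTrapezoid m n k)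

/-- The paths that go down between the times `r` and `r + 1`, the first path being frozen from
time `a` on. -/
noncomputable def moves (a r : ℕ) : Finset (Fin (m + n - 1)) := open Classical in
  Finset.univ.filter fun v =>
    r < n ∧ T.height (r + 1) (v + 1) < T.height r (v + 1) ∧ ((v : ℕ) ≠ 0 ∨ r < a)

theorem mem_moves {a r : ℕ} {v : Fin (m + n - 1)} : v ∈ T.moves a r ↔
    r < n ∧ T.height (r + 1) (v + 1) < T.height r (v + 1) ∧ ((v : ℕ) ≠ 0 ∨ r < a) := by
  simp [moves]

/-- The positions at which the paths start. -/
noncomputable def startPos (N k : ℕ) : Fin N →₀ ℕ :=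
  Finsupp.equivFunOnFinite.symm fun v => (v : ℕ) + k - 1

@[simp]
theorem startPos_apply (N k : ℕ) (v : Fin N) : startPos N k v = (v : ℕ) + k - 1 := rfl

theorem strictMono_startPos {N k : ℕ} (hk : 1 ≤ k) : StrictMono (startPos N k) := by
  intro v v' h
  rw [Fin.lt_def] at h
  simp only [startPos_apply]
  omega

/-- The positions at time `r` of the paths of a trapezoid. -/
noncomputable def position (a r : ℕ) : Fin (m + n - 1) →₀ ℕ :=
  stateAfter (fun l u => l - unitExp u) (startPos (m + n - 1) k) (T.moves a) r

theorem position_succ_apply (a r : ℕ) (v : Fin (m + n - 1)) : T.position a (r + 1) v =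
    T.position a r v - if v ∈ T.moves a r then 1 else 0 := by
  classical
  change (T.position a r - unitExp (T.moves a r)) v = _
  rw [Finsupp.tsub_apply, unitExp_apply]

theorem one_le_position_of_mem_moves {a r : ℕ} (h1 : 1 ≤ T.height a 1) (han : a ≤ n)
    {v : Fin (m + n - 1)} (hv : v ∈ T.moves a r)
    (h : T.position a r v + 1 = v + T.height r (v + 1)) : 1 ≤ T.position a r v := by
  obtain ⟨hr, hlt, hva⟩ := T.mem_moves.1 hv
  rcases Nat.eq_zero_or_pos (v : ℕ) with h0 | h0
  · have := T.height_antitone 1 (show r + 1 ≤ a by omega) han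
    simp only [h0, Nat.zero_add] at hlt h
    omega
  · omega

/-- A position is `v + height - 1`. The first path has height exactly `1`, hence position `0`, at
time `a < n`; its final drop to height `0` has no counterpart among the positions and is left out of
`moves`. -/
theorem position_spec (hk : 1 ≤ k) {a : ℕ} (hka : k ≤ a + 1) (han : a ≤ n)
    (h1 : 1 ≤ T.height a 1) (h0 : a < n → T.height (a + 1) 1 = 0) {r : ℕ} (hr : r ≤ n) :
    (∀ v : Fin (m + n - 1), (v : ℕ) ≠ 0 ∨ r ≤ a →
      T.position a r v + 1 = v + T.height r (v + 1)) ∧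
    (a ≤ r → a < n → ∀ v : Fin (m + n - 1), (v : ℕ) = 0 → T.position a r v = 0) := by
  induction r with
  | zero =>
    have hp : ∀ v : Fin (m + n - 1), T.position a 0 v = v + k - 1 := fun v => rfl
    refine ⟨fun v _ => ?_, fun h _ v hv => ?_⟩
    · rw [hp, T.height_zero hk]
      omega
    · rw [hp]
      omega
  | succ r ih =>
    obtain ⟨ih1, ih2⟩ := ih (by omega)
    have hfst : ∀ v : Fin (m + n - 1), (v : ℕ) ≠ 0 ∨ r + 1 ≤ a →
        T.position a (r + 1) v + 1 = v + T.height (r + 1) (v + 1) := by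
      intro v hv
      have e := ih1 v (by omega)
      have h2 := T.height_succ_le (v + 1) hr
      have h3 := T.height_le_succ (v + 1) hr
      rw [position_succ_apply]
      split_ifs with hmem
      · have := T.one_le_position_of_mem_moves h1 han hmem e
        have := (T.mem_moves.1 hmem).2.1
        omega
      · have : ¬ T.height (r + 1) (v + 1) < T.height r (v + 1) := fun h =>
          hmem (T.mem_moves.2 ⟨hr, h, by omega⟩)
        omega
    refine ⟨hfst, fun har ha v hv => ?_⟩
    rcases har.eq_or_lt with rfl | hlt
    · have := hfst v (Or.inr le_rfl)
      have := T.height_le_succ 1 ha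
      have := h0 ha
      simp only [hv, Nat.zero_add] at *
      omega
    · rw [position_succ_apply, ih2 (by omega) ha v hv, Nat.zero_sub]

theorem moves_mem_moveSeqs (hk : 1 ≤ k) {a : ℕ} (hka : k ≤ a + 1) (han : a ≤ n)
    (h1 : 1 ≤ T.height a 1) (h0 : a < n → T.height (a + 1) 1 = 0) :
    T.moves a ∈ moveSeqs (fun l u => l - unitExp u) (startPos (m + n - 1) k)
      (PathMove m n a) n := by
  rw [mem_moveSeqs]
  refine ⟨fun s hs => ?_, fun r hr => ⟨fun v hv => ?_, ?_, ?_, ?_⟩⟩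
  · refine Finset.eq_empty_of_forall_notMem fun v hv => ?_
    have := (T.mem_moves.1 hv).1
    omega
  · obtain ⟨_, h2, h3⟩ := T.mem_moves.1 hv
    refine ⟨?_, h3⟩
    by_contra hvm
    have := T.height_eq hk (r := r + 1) (v := v + 1) hr (by omega)
    have := T.height_le r (v + 1)
    omega
  · rw [unitExp_le_iff]
    intro v hv
    exact T.one_le_position_of_mem_moves h1 han hv
      ((T.position_spec hk hka han h1 h0 hr.le).1 v (by have := (T.mem_moves.1 hv).2.2; omega))
  · intro v hv v' hv' hlt
    have hs := (T.position_spec hk hka han h1 h0 (r := r + 1) hr).1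
    have e := hs v hv
    have e' := hs v' hv'
    have := T.height_mono (r + 1) (show (v : ℕ) + 1 ≤ v' + 1 by rw [Fin.lt_def] at hlt; omega)
    rw [Fin.lt_def] at hlt
    change T.position a (r + 1) v < T.position a (r + 1) v'
    omega
  · exact (T.position_spec hk hka han h1 h0 (r := r + 1) hr).2

/-- The entry `a_{k,r+1}` is a maximum iff the height for `m + r`, which is `k` at time `r`, drops
at once; this is the marked step of path `m + r - 1`. For `m = r = 0` there is no such path and the
maximum is forced. -/
theorem X_pow_numMaxima (hk : 1 ≤ k) (hn : 1 ≤ n) {a : ℕ} (han : a ≤ n)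
    (hma : a < n → 1 < m + a) :
    (Polynomial.X : Polynomial ℤ) ^ T.numMaxima = (if m = 0 then Polynomial.X else 1) *
      ∏ r ∈ Finset.range n, ∏ v ∈ T.moves a r, stepWeight m r v := by
  classical
  have hmax : (Polynomial.X : Polynomial ℤ) ^ T.numMaxima = ∏ r ∈ Finset.range n,
      if T.entry k (r + 1) = m + (r + 1) then Polynomial.X else 1 := by
    rw [numMaxima, ← Finset.prod_const, Finset.prod_filter]
    symm
    refine Finset.prod_nbij (fun r => r + 1) ?_ ?_ ?_ fun _ _ => rfl
    · intro r hr
      simp only [Finset.mem_range, Finset.mem_Icc] at *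
      omega
    · intro r _ r' _ h
      simpa using h
    · intro i hi
      simp only [Finset.coe_Icc, Set.mem_Icc] at hi
      exact ⟨i - 1, by simp; omega, by simp; omega⟩
  have hzero : (if m = 0 then (Polynomial.X : Polynomial ℤ) else 1) =
      ∏ r ∈ Finset.range n, if m + r = 0 then Polynomial.X else 1 := by
    rw [Finset.prod_eq_single 0]
    · rw [Nat.add_zero]
    · intro r _ hr
      rw [if_neg (by omega)]
    · intro h
      exact absurd (Finset.mem_range.2 hn) h
  rw [hmax, hzero, ← Finset.prod_mul_distrib]
  refine Finset.prod_congr rfl fun r hr => ?_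
  rw [Finset.mem_range] at hr
  have hcell : MagogCell n k k (r + 1) := ⟨hk, le_rfl, by omega, by omega⟩
  have hb := T.le_bound _ _ hcell
  have hp := T.pos _ _ hcell
  rcases Nat.eq_zero_or_pos (m + r) with h | h
  · rw [if_pos h, if_pos (by omega), Finset.prod_eq_one, mul_one]
    intro v _
    rw [stepWeight, if_neg (by omega)]
  rw [if_neg h.ne', one_mul]
  have hv0 : m + r - 1 < m + n - 1 := by omega
  have hw : ∀ v ∈ T.moves a r, stepWeight m r v =
      if v = ⟨m + r - 1, hv0⟩ then (Polynomial.X : Polynomial ℤ) else 1 := by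
    intro v _
    rw [stepWeight]
    refine if_congr ?_ rfl rfl
    rw [Fin.ext_iff]
    simp only
    omega
  rw [Finset.prod_congr rfl hw, Finset.prod_ite_eq']
  refine if_congr ?_ rfl rfl
  rw [mem_moves]
  simp only [show m + r - 1 + 1 = m + r by omega]
  have e1 := T.height_eq hk (r := r) hr.le le_rfl
  have e2 := T.height_le (r + 1) (m + r)
  have e3 := T.le_height_iff (r := r + 1) (v := m + r) (d := k) hr hk le_rfl
  rw [show k + (r + 1) - k = r + 1 by omega] at e3
  constructor
  · intro he
    refine ⟨hr, ?_, ?_⟩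
    · rw [e1]
      by_contra hcon
      have := e3.1 (by omega)
      omega
    -- A marked step of the first path at or after time `a` would be invisible; `hma` excludes it.
    · by_contra hcon
      have := hma (by omega)
      omega
  · rintro ⟨_, h2, _⟩
    by_contra hcon
    have := e3.2 (by omega)
    omega

theorem moves_injective (hk : 1 ≤ k) {a : ℕ} (hka : k ≤ a + 1) (han : a ≤ n)
    {T T' : MagogTrapezoid m n k}
    (h1 : 1 ≤ T.height a 1) (h0 : a < n → T.height (a + 1) 1 = 0)
    (h1' : 1 ≤ T'.height a 1) (h0' : a < n → T'.height (a + 1) 1 = 0)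
    (h : T.moves a = T'.moves a) : T = T' := by
  refine ext_height fun r hr v hv hv' => ?_
  obtain ⟨v, rfl⟩ : ∃ w, v = w + 1 := ⟨v - 1, by omega⟩
  by_cases hc : v ≠ 0 ∨ r ≤ a
  · have e := (T.position_spec hk hka han h1 h0 hr).1 ⟨v, by omega⟩ hc
    have e' := (T'.position_spec hk hka han h1' h0' hr).1 ⟨v, by omega⟩ hc
    simp only [position, h] at e e'
    omega
  · obtain rfl : v = 0 := by omega
    have e := T.height_antitone 1 (show a + 1 ≤ r by omega) hr
    have e' := T'.height_antitone 1 (show a + 1 ≤ r by omega) hr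
    rw [h0 (by omega)] at e
    rw [h0' (by omega)] at e'
    simp only [Nat.zero_add]
    omega

theorem exists_moves_eq (hk : 1 ≤ k) (hn : 1 ≤ n) {a : ℕ} (hka : k ≤ a + 1) (han : a ≤ n)
    (hma : a < n → 1 < m + a) {U : ℕ → Finset (Fin (m + n - 1))}
    (hU : U ∈ moveSeqs (fun l u => l - unitExp u) (startPos (m + n - 1) k)
      (PathMove m n a) n) :
    ∃ T : MagogTrapezoid m n k, 1 ≤ T.height a 1 ∧ (a < n → T.height (a + 1) 1 = 0) ∧
      T.moves a = U := by
  classical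
  have hstate0 : PathState n a 0 (startPos (m + n - 1) k) :=
    ⟨(strictMono_startPos hk).strictMonoOn _, fun h _ v hv => by
      rw [startPos_apply]; omega⟩
  set l : ℕ → Fin (m + n - 1) →₀ ℕ :=
    stateAfter (fun l u => l - unitExp u) (startPos (m + n - 1) k) U with hl
  have hst : ∀ r ≤ n, PathState n a r (l r) := fun r hr => moveSeqs_state hstate0 hU hr
  have hmv : ∀ r < n, PathMove m n a r (l r) (U r) := (mem_moveSeqs.1 hU).2
  have hsucc : ∀ r v, l (r + 1) v = l r v - if v ∈ U r then 1 else 0 := by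
    intro r v
    change (l r - unitExp (U r)) v = _
    rw [Finsupp.tsub_apply, unitExp_apply]
  have hpos : ∀ r < n, ∀ v ∈ U r, 1 ≤ l r v := fun r hr => unitExp_le_iff.1 (hmv r hr).2.1
  have hfix : ∀ r ≤ n, ∀ v : Fin (m + n - 1), m + r ≤ (v : ℕ) + 1 → l r v = v + k - 1 := by
    intro r
    induction r with
    | zero => exact fun _ v _ => rfl
    | succ r ih =>
      intro hr v hv
      rw [hsucc, ih (by omega) v (by omega), if_neg, Nat.sub_zero]
      intro hmem
      have := ((hmv r hr).1 v hmem).1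
      omega
  have hup : ∀ r v, l r v ≤ v + k - 1 := by
    intro r v
    induction r with
    | zero => exact le_rfl
    | succ r ih =>
      rw [hsucc]
      omega
  -- Strictly increasing positions of the paths other than the first satisfy `v - 1 ≤ l r v`, so the
  -- truncated subtraction in `h` below is exact.
  have hlow : ∀ r ≤ n, ∀ v : ℕ, ∀ hv : v < m + n - 1, (v ≠ 0 ∨ r ≤ a) → v ≤ l r ⟨v, hv⟩ + 1 := by
    intro r hr v
    induction v with
    | zero => exact fun _ _ => Nat.zero_le _
    | succ v ih =>
      intro hv _
      rcases Nat.eq_zero_or_pos v with h0 | h0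
      · omega
      · have h2 := ih (by omega) (Or.inl h0.ne')
        have h3 : l r ⟨v, by omega⟩ < l r ⟨v + 1, hv⟩ :=
          (hst r hr).1 (Or.inl h0.ne') (Or.inl (Nat.succ_ne_zero v)) (by simp [Fin.lt_def])
        omega
  -- Heights are read off from positions, with `0` for the first path after the cut and `k` for
  -- thresholds beyond `m + n - 1`, where there is no path.
  let h : ℕ → ℕ → ℕ := fun r v =>
    if hv : v - 1 < m + n - 1 then
      if v - 1 ≠ 0 ∨ r ≤ a then l r ⟨v - 1, hv⟩ + 1 - (v - 1) else 0
    else k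
  have hh : ∀ r (v : Fin (m + n - 1)), ((v : ℕ) ≠ 0 ∨ r ≤ a) →
      h r (v + 1) = l r v + 1 - v := by
    intro r v hv
    simp only [h, Nat.add_sub_cancel]
    rw [dif_pos v.2, if_pos hv]
  have hh0 : ∀ r (v : Fin (m + n - 1)), (v : ℕ) = 0 → a < r → h r (v + 1) = 0 := by
    intro r v hv hr
    simp only [h, Nat.add_sub_cancel]
    rw [dif_pos v.2, if_neg (by omega)]
  have hhk : ∀ r v, m + n - 1 < v → h r v = k := by
    intro r v hv
    simp only [h]
    rw [dif_neg (by omega)]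
  have hN : a < n → 0 < m + n - 1 := fun h => by have := hma h; omega
  have hmono1 : ∀ r ≤ n, ∀ v, 1 ≤ v → h r v ≤ h r (v + 1) := by
    intro r hr v hv
    rcases lt_or_ge (m + n - 1) v with hvn | hvn
    · rw [hhk _ v hvn, hhk _ _ (by omega)]
    obtain ⟨w, rfl⟩ : ∃ w : Fin (m + n - 1), v = w + 1 := ⟨⟨v - 1, by omega⟩, by simp; omega⟩
    by_cases hw : (w : ℕ) ≠ 0 ∨ r ≤ a
    swap
    · rw [hh0 r w (by omega) (by omega)]
      exact Nat.zero_le _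
    rw [hh r w hw]
    rcases hvn.eq_or_lt with hwn | hwn
    · rw [hhk _ _ (by omega)]
      have := hup r w
      omega
    · have h3 : l r w < l r ⟨w + 1, hwn⟩ :=
        (hst r hr).1 hw (Or.inl (Nat.succ_ne_zero w)) (by simp [Fin.lt_def])
      have h4 := hh r ⟨w + 1, hwn⟩ (Or.inl (Nat.succ_ne_zero w))
      simp only at h4
      rw [h4]
      omega
  have hstep : ∀ r < n, ∀ v, 1 ≤ v → h (r + 1) v ≤ h r v ∧ h r v ≤ h (r + 1) v + 1 := by
    intro r hr v hv
    rcases lt_or_ge (m + n - 1) v with hvn | hvn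
    · rw [hhk _ v hvn, hhk _ v hvn]
      omega
    obtain ⟨w, rfl⟩ : ∃ w : Fin (m + n - 1), v = w + 1 := ⟨⟨v - 1, by omega⟩, by simp; omega⟩
    have hs := hsucc r w
    rcases lt_or_ge r a with hra | hra
    · rw [hh r w (by omega), hh (r + 1) w (by omega)]
      split_ifs at hs <;> omega
    rcases Nat.eq_zero_or_pos (w : ℕ) with hw | hw
    · rw [hh0 (r + 1) w hw (by omega)]
      rcases hra.eq_or_lt with rfl | hra
      · rw [hh a w (by omega), (hst a hr.le).2 le_rfl hr w hw]
        omega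
      · rw [hh0 r w hw hra]
        omega
    · rw [hh r w (by omega), hh (r + 1) w (by omega)]
      split_ifs at hs <;> omega
  have hzero : ∀ v, 1 ≤ v → h 0 v = k := by
    intro v hv
    rcases lt_or_ge (m + n - 1) v with hvn | hvn
    · exact hhk _ v hvn
    obtain ⟨w, rfl⟩ : ∃ w : Fin (m + n - 1), v = w + 1 := ⟨⟨v - 1, by omega⟩, by simp; omega⟩
    rw [hh 0 w (Or.inr (Nat.zero_le a)), show l 0 w = w + k - 1 from rfl]
    omega
  have hmono : ∀ r ≤ n, ∀ v v', 1 ≤ v → v ≤ v' → h r v ≤ h r v' := by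
    intro r hr v v' hv hvv
    induction v', hvv using Nat.le_induction with
    | base => exact le_rfl
    | succ v' hvv ih => exact ih.trans (hmono1 r hr v' (by omega))
  have htop : ∀ r ≤ n, ∀ v, 1 ≤ v → m + r ≤ v → h r v = k := by
    intro r hr v hv hmr
    rcases lt_or_ge (m + n - 1) v with hvn | hvn
    · exact hhk _ v hvn
    obtain ⟨w, rfl⟩ : ∃ w : Fin (m + n - 1), v = w + 1 := ⟨⟨v - 1, by omega⟩, by simp; omega⟩
    have hw : (w : ℕ) ≠ 0 ∨ r ≤ a := by
      by_contra hcon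
      have := hma (by omega)
      omega
    rw [hh r w hw, hfix r hr w hmr]
    omega
  obtain ⟨T, hT⟩ := exists_height_eq (m := m) (n := n) (k := k) h hzero hmono htop hstep
  refine ⟨T, ?_, ?_, ?_⟩
  · rw [hT a han 1 le_rfl]
    rcases Nat.eq_zero_or_pos (m + n - 1) with h0 | h0
    · rw [hhk _ _ (by omega)]
      exact hk
    · have := hh a ⟨0, h0⟩ (Or.inr le_rfl)
      simp only [Nat.zero_add] at this
      omega
  · intro han'
    rw [hT _ han' _ le_rfl]
    exact hh0 (a + 1) ⟨0, hN han'⟩ rfl (by omega)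
  · funext r
    ext v
    rw [mem_moves]
    constructor
    · rintro ⟨hr, h2, h3⟩
      rw [hT _ hr _ (by omega), hT _ hr.le _ (by omega), hh r v (by omega),
        hh (r + 1) v (by omega), hsucc] at h2
      by_contra hv
      rw [if_neg hv] at h2
      omega
    · intro hv
      have hr : r < n := by
        by_contra hr
        rw [(mem_moveSeqs.1 hU).1 r (by omega)] at hv
        exact absurd hv (Finset.notMem_empty v)
      have h3 := ((hmv r hr).1 v hv).2
      refine ⟨hr, ?_, h3⟩
      have h4 := hpos r hr v hv
      have h5 := hlow (r + 1) hr v v.2 (by omega)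
      rw [hT _ hr _ (by omega), hT _ hr.le _ (by omega), hh r v (by omega),
        hh (r + 1) v (by omega)]
      have h6 := hsucc r v
      rw [if_pos hv] at h6
      simp only [Fin.eta] at h5
      omega

end MagogTrapezoid

open MagogTrapezoid in
theorem magogGenFun_eq {m n k q : ℕ} (hk : 1 ≤ k) (hkn : k ≤ n) (hq : q ≤ n - k + 1)
    (hma : k + q - 1 < n → 1 < m + (k + q - 1)) :
    magogGenFun m n k q = (if m = 0 then Polynomial.X else 1) *
      pathSum m n (k + q - 1) (startPos (m + n - 1) k) := by
  rw [magogGenFun, pathSum, Finset.mul_sum]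
  have hmem : ∀ T : MagogTrapezoid m n k, T ∈ Finset.univ.filter (fun T => T.numMinima = q) ↔
      1 ≤ T.height (k + q - 1) 1 ∧ (k + q - 1 < n → T.height (k + q - 1 + 1) 1 = 0) := by
    intro T
    rw [Finset.mem_filter, and_iff_right (Finset.mem_univ T), T.numMinima_eq_iff hk hkn hq]
  refine Finset.sum_bij (fun T _ => T.moves (k + q - 1)) ?_ ?_ ?_ ?_
  · intro T hT
    rw [hmem] at hT
    exact T.moves_mem_moveSeqs hk (by omega) (by omega) hT.1 hT.2
  · intro T hT T' hT' h
    rw [hmem] at hT hT'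
    exact moves_injective hk (by omega) (by omega) hT.1 hT.2 hT'.1 hT'.2 h
  · intro U hU
    obtain ⟨T, h1, h2, h3⟩ := exists_moves_eq hk (by omega) (by omega) (by omega) hma hU
    exact ⟨T, (hmem T).2 ⟨h1, h2⟩, h3⟩
  · intro T _
    exact T.X_pow_numMaxima hk (by omega) (by omega) hma

/-! ### From power series to the rational expressions. -/

section ConstantTerm

variable {N : ℕ}

/-- The embedding of the power series into their field of fractions. -/
noncomputable abbrev ctMap (N : ℕ) :
    MvPowerSeries (Fin N) (Polynomial ℤ) →+* CTField (Fin N) :=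
  algebraMap (MvPowerSeries (Fin N) (Polynomial ℤ)) (CTField (Fin N))

theorem ctMap_injective (N : ℕ) : Function.Injective (ctMap N) :=
  IsFractionRing.injective (MvPowerSeries (Fin N) (Polynomial ℤ)) (CTField (Fin N))

theorem ctMap_X (v : Fin N) : ctMap N (MvPowerSeries.X v) = ctVar v := rfl

theorem ctMap_ne_zero_of_constantCoeff {φ : MvPowerSeries (Fin N) (Polynomial ℤ)}
    (h : MvPowerSeries.constantCoeff φ ≠ 0) : ctMap N φ ≠ 0 := by
  intro h0
  rw [ctMap_injective N (h0.trans (map_zero _).symm), map_zero] at h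
  exact h rfl

theorem ctVar_ne_zero (v : Fin N) : ctVar v ≠ 0 := by
  intro h
  have h1 := ctMap_injective N (h.trans (map_zero (ctMap N)).symm)
  have h2 := congrArg (MvPowerSeries.coeff (Finsupp.single v 1)) h1
  simp at h2

theorem one_add_ctVar_ne_zero (v : Fin N) : 1 + ctVar v ≠ 0 := by
  rw [← ctMap_X, ← map_one (ctMap N), ← map_add]
  exact ctMap_ne_zero_of_constantCoeff (by simp)

theorem one_sub_ctVar_ne_zero (v : Fin N) : 1 - ctVar v ≠ 0 := by
  rw [← ctMap_X, ← map_one (ctMap N), ← map_sub]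
  exact ctMap_ne_zero_of_constantCoeff (by simp)

theorem one_sub_ctVar_mul_ne_zero (v w : Fin N) : 1 - ctVar v * ctVar w ≠ 0 := by
  rw [← ctMap_X, ← ctMap_X, ← map_mul, ← map_one (ctMap N), ← map_sub]
  exact ctMap_ne_zero_of_constantCoeff (by simp)

theorem ctVar_sub_ne_zero {v w : Fin N} (h : v ≠ w) : ctVar w - ctVar v ≠ 0 :=
  sub_ne_zero.2 fun e => h (MvPowerSeries.X_inj.1 (ctMap_injective N e)).symm

theorem ctMap_signSeries (V : Finset (Fin N)) :
    ctMap N (signSeries (Polynomial ℤ) V) = (∏ i ∈ V, (1 - ctVar i)⁻¹) *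
      pairProd V fun i j => (ctVar j - ctVar i) / (1 - ctVar i * ctVar j) :=
  map_signSeries (ctMap N) (ctMap_injective N) V

/-- The summand of `S_q` cancels every factor containing `x_i` in the product formula; the sign
comes from the `i` factors in which `x_i` is the larger variable. -/
theorem ctMap_signSeries_univ_mul (i : Fin N) :
    ctMap N (signSeries (Polynomial ℤ) Finset.univ) * ((1 - ctVar i) *
      ∏ j ∈ Finset.univ.erase i, (1 - ctVar i * ctVar j) / (ctVar j - ctVar i)) =
    (-1) ^ (i : ℕ) * ctMap N (signSeries (Polynomial ℤ) (Finset.univ.erase i)) := by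
  have hcard : (Finset.univ.filter (fun v : Fin N => v < i)).card = i := by
    rw [show Finset.univ.filter (fun v : Fin N => v < i) = Finset.Iio i by ext; simp, Fin.card_Iio]
  rw [ctMap_signSeries, ctMap_signSeries,
    pairProd_eq_mul_erase_of_antisymm (Finset.mem_univ i) (fun j => by
      rw [mul_comm (ctVar j), ← neg_sub, neg_div]), hcard,
    ← Finset.mul_prod_erase Finset.univ _ (Finset.mem_univ i)]
  have h1 : (∏ j ∈ Finset.univ.erase i, (1 - ctVar i * ctVar j) / (ctVar j - ctVar i)) *
      ∏ j ∈ Finset.univ.erase i, (ctVar j - ctVar i) / (1 - ctVar i * ctVar j) = 1 := by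
    rw [← Finset.prod_mul_distrib]
    refine Finset.prod_eq_one fun j hj => ?_
    have := one_sub_ctVar_mul_ne_zero i j
    have := ctVar_sub_ne_zero (Finset.ne_of_mem_erase hj).symm
    field_simp
  have h2 := mul_inv_cancel₀ (one_sub_ctVar_ne_zero i)
  generalize (∏ j ∈ Finset.univ.erase i, (1 - ctVar i * ctVar j) / (ctVar j - ctVar i)) = p at *
  generalize (∏ j ∈ Finset.univ.erase i, (ctVar j - ctVar i) / (1 - ctVar i * ctVar j)) = p' at *
  generalize (1 - ctVar i)⁻¹ = u at *
  generalize (∏ j ∈ Finset.univ.erase i, (1 - ctVar j)⁻¹) = c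
  generalize pairProd (Finset.univ.erase i)
    (fun i j => (ctVar j - ctVar i) / (1 - ctVar i * ctVar j)) = D
  linear_combination (c * (-1) ^ (i : ℕ) * D) * ((1 - ctVar i) * u * h1 + h2)

theorem ctMap_stepSeries {m t : ℕ} {v : Fin N} (hv : (v : ℕ) + 1 < m + t) :
    ctMap N (stepSeries m 0 t v) = (1 + ctVar v) ^ t * (if max m 1 ≤ (v : ℕ) + 1 then
      (1 + ctVar v) ^ ((m : ℤ) - (((v : ℕ) : ℤ) + 1) - 1) * (ctP (Fin N) * ctVar v + 1) else 1) := by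
  have hone : ∀ s, (v : ℕ) + 1 ≠ m + s →
      ctMap N (1 + MvPowerSeries.C (stepWeight m s v) * MvPowerSeries.X v) = 1 + ctVar v := by
    intro s hs
    rw [stepWeight, if_neg hs, map_one, one_mul, map_add, map_one, ctMap_X]
  rw [stepSeries, map_prod]
  split_ifs with hmv
  -- Path `v` becomes active at time `v + 1 - m`, where its step is marked, leaving `t + m - v - 2`
  -- unmarked factors. In the other case `v + 1 < m`, so the path is active throughout and never
  -- marked.
  · have hset : (Finset.Ico 0 t).filter (fun s => (v : ℕ) < m + s) =
        insert (v + 1 - m) (Finset.Ico (v + 2 - m) t) := by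
      ext s
      simp only [Finset.mem_filter, Finset.mem_Ico, Finset.mem_insert]
      omega
    rw [hset, Finset.prod_insert (by simp; omega), Finset.prod_congr rfl fun s hs => hone s (by
      rw [Finset.mem_Ico] at hs; omega), Finset.prod_const, Nat.card_Ico, stepWeight,
      if_pos (by omega), map_add, map_mul, map_one, ctMap_X,
      show ctMap N (MvPowerSeries.C Polynomial.X) = ctP (Fin N) from rfl, ← mul_assoc,
      ← zpow_natCast _ t, ← zpow_add₀ (one_add_ctVar_ne_zero v), ← zpow_natCast,
      mul_comm, add_comm (1 : CTField (Fin N)) (ctP (Fin N) * ctVar v)]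
    congr 2
    omega
  · rw [mul_one, Finset.filter_true_of_mem fun s _ => by omega,
      Finset.prod_congr rfl fun s _ => hone s (by omega), Finset.prod_const, Nat.card_Ico,
      Nat.sub_zero]

theorem ctMap_monomial (e : Fin N →₀ ℕ) :
    ctMap N (MvPowerSeries.monomial e 1) = ∏ v, ctVar v ^ e v := by
  rw [Finset.prod_congr rfl fun v _ => by rw [← ctMap_X, ← map_pow, MvPowerSeries.X_pow_eq],
    ← map_prod, MvPowerSeries.prod_monomial, Finsupp.univ_sum_single, Finset.prod_const_one]

/-- The weight of the forced maximum in the case `m = 0`. -/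
noncomputable def initialWeight (m : ℕ) : Polynomial ℤ := if m = 0 then Polynomial.X else 1

open MagogTrapezoid in
theorem ctMap_monomial_mul_magogKernel {m n k : ℕ} (hk : 1 ≤ k) :
    ctMap (m + n - 1) (MvPowerSeries.monomial (startPos (m + n - 1) k) 1) * magogKernel m n k =
      ctMap (m + n - 1) (MvPowerSeries.C (initialWeight m) * ((∏ v, stepSeries m 0 n v) *
        signSeries (Polynomial ℤ) Finset.univ)) := by
  have hw : ctMap (m + n - 1) (MvPowerSeries.C (initialWeight m)) =
      if m = 0 then ctP (Fin (m + n - 1)) else 1 := by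
    rw [initialWeight]
    split_ifs
    · rfl
    · rw [map_one, map_one]
  have hprod : (∏ v : Fin (m + n - 1), ctVar v ^ startPos (m + n - 1) k v) *
      ((∏ i : Fin (m + n - 1), (1 + ctVar i) ^ n *
        ctVar i ^ (-(((i : ℕ) : ℤ) + 1) - (k : ℤ) + 2) * (1 - ctVar i)⁻¹) *
      ∏ i ∈ Finset.univ.filter (fun i : Fin (m + n - 1) => max m 1 ≤ (i : ℕ) + 1),
        (1 + ctVar i) ^ ((m : ℤ) - (((i : ℕ) : ℤ) + 1) - 1) *
          (ctP (Fin (m + n - 1)) * ctVar i + 1)) =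
      (∏ v, ctMap (m + n - 1) (stepSeries m 0 n v)) * ∏ v, (1 - ctVar v)⁻¹ := by
    rw [Finset.prod_filter, ← Finset.prod_mul_distrib, ← Finset.prod_mul_distrib,
      ← Finset.prod_mul_distrib]
    refine Finset.prod_congr rfl fun v _ => ?_
    rw [ctMap_stepSeries (by omega)]
    have hx : ctVar v ^ startPos (m + n - 1) k v *
        ctVar v ^ (-(((v : ℕ) : ℤ) + 1) - (k : ℤ) + 2) = 1 := by
      rw [← zpow_natCast, ← zpow_add₀ (ctVar_ne_zero v), startPos_apply]
      convert zpow_zero _ using 2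
      omega
    linear_combination ((1 + ctVar v) ^ n * (1 - ctVar v)⁻¹ *
      (if max m 1 ≤ (v : ℕ) + 1 then (1 + ctVar v) ^ ((m : ℤ) - (((v : ℕ) : ℤ) + 1) - 1) *
        (ctP (Fin (m + n - 1)) * ctVar v + 1) else 1)) * hx
  rw [map_mul, map_mul, hw, map_prod, ctMap_signSeries, ctMap_monomial, magogKernel, pairProd]
  linear_combination ((if m = 0 then ctP (Fin (m + n - 1)) else 1) *
    ∏ i : Fin (m + n - 1), ∏ j ∈ Finset.univ.filter (fun j : Fin (m + n - 1) => i < j),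
      (ctVar j - ctVar i) / (1 - ctVar i * ctVar j)) * hprod

/-- With `a = k + q - 1` the exponent of `1 + x_i` is `a - n`, which deletes the steps of path `i`
after time `a`. The range of summation is `i + 1 < m + a` for zero-based `i`: these paths are past
their marked step, so only unmarked factors need deleting. -/
theorem ctMap_mul_magogSum {m n k q : ℕ} (hk : 1 ≤ k) (hkq : k + q - 1 ≤ n) :
    ctMap (m + n - 1) ((∏ v, stepSeries m 0 n v) * signSeries (Polynomial ℤ) Finset.univ) *
      magogSum m n k q =
    ctMap (m + n - 1) ((∏ v, stepSeries m 0 (k + q - 1) v) *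
      cutSeries (m + n - 1) m (k + q - 1) n) := by
  rw [magogSum, cutSeries, Finset.mul_sum, Finset.mul_sum, map_sum]
  refine Finset.sum_congr (Finset.filter_congr fun i _ => by omega) fun i hi => ?_
  rw [Finset.mem_filter] at hi
  have hstep : ctMap (m + n - 1) (stepSeries m 0 n i) *
      (1 + ctVar i) ^ ((k : ℤ) + (q : ℤ) - (n : ℤ) - 1) =
      ctMap (m + n - 1) (stepSeries m 0 (k + q - 1) i) := by
    rw [ctMap_stepSeries (by omega), ctMap_stepSeries hi.2, mul_right_comm]
    congr 1
    rw [← zpow_natCast, ← zpow_natCast, ← zpow_add₀ (one_add_ctVar_ne_zero i)]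
    congr 1
    omega
  have hprod : (∏ v ∈ Finset.univ.erase i, stepSeries m 0 (k + q - 1) v) *
      (∏ v ∈ Finset.univ.erase i, stepSeries m (k + q - 1) n v) =
      ∏ v ∈ Finset.univ.erase i, stepSeries m 0 n v := by
    rw [← Finset.prod_mul_distrib]
    exact Finset.prod_congr rfl fun v _ => stepSeries_mul m (Nat.zero_le _) hkq v
  rw [Finset.filter_ne', ← Finset.mul_prod_erase _ _ (Finset.mem_univ i),
    ← Finset.mul_prod_erase _ _ (Finset.mem_univ i), ← hprod]
  simp only [map_mul, map_pow, map_neg, map_one]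
  rw [← hstep]
  linear_combination (ctMap (m + n - 1) (stepSeries m 0 n i) *
    ctMap (m + n - 1) (∏ v ∈ Finset.univ.erase i, stepSeries m 0 (k + q - 1) v) *
    ctMap (m + n - 1) (∏ v ∈ Finset.univ.erase i, stepSeries m (k + q - 1) n v) *
    (1 + ctVar i) ^ ((k : ℤ) + (q : ℤ) - (n : ℤ) - 1)) * ctMap_signSeries_univ_mul i

theorem magogGenFun_zero_zero {n k : ℕ} (hk : 1 ≤ k) (hkn : k ≤ n) : magogGenFun 0 n k 0 = 0 := by
  rw [magogGenFun, Finset.filter_false_of_mem, Finset.sum_empty]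
  intro T _ h
  rw [MagogTrapezoid.numMinima, Finset.card_eq_zero, Finset.filter_eq_empty_iff] at h
  have hc : MagogCell n k 1 1 := ⟨le_rfl, hk, le_rfl, by omega⟩
  have h1 := T.pos 1 1 hc
  have h2 := T.le_bound 1 1 hc
  exact h (Finset.mem_Icc.2 ⟨le_rfl, by omega⟩) (by omega)

end ConstantTerm

open MagogTrapezoid in
theorem mainTheorem9 (m n k q : ℕ) (hk : 1 ≤ k) (hkn : k ≤ n) (hex : k ≠ 1 ∨ m + q ≠ 1) :
    (q ≤ n - k →
      HasConstantTerm (magogKernel m n k * magogSum m n k q) (magogGenFun m n k q)) ∧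
    (q = n - k + 1 →
      HasConstantTerm (magogKernel m n k) (magogGenFun m n k q)) := by
  constructor
  · intro hq
    rcases Nat.lt_or_ge 1 (m + (k + q - 1)) with hma | hma
    · refine ⟨startPos (m + n - 1) k, MvPowerSeries.C (initialWeight m) *
        ((∏ v, stepSeries m 0 (k + q - 1) v) * cutSeries (m + n - 1) m (k + q - 1) n), ?_, ?_⟩
      · rw [← mul_assoc, ctMap_monomial_mul_magogKernel hk, map_mul, mul_assoc,
          ctMap_mul_magogSum hk (by omega), ← map_mul]
      · rw [MvPowerSeries.coeff_C_mul, coeff_prod_stepSeries_mul_cutSeries (by omega) hma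
          (z := ⟨0, by omega⟩) rfl (strictMono_startPos hk)
          (fun h => by rw [startPos_apply]; simp only; omega),
          magogGenFun_eq hk hkn (by omega) fun _ => hma]
        rfl
    -- By `hex` only `m = q = 0` with `k ≤ 2` is left. The sum is then empty, and there are no
    -- trapezoids to count because `a_{1,1} = 1` is forced.
    · obtain ⟨rfl, rfl⟩ : m = 0 ∧ q = 0 := by omega
      rw [magogGenFun_zero_zero hk hkn, magogSum, Finset.filter_false_of_mem fun i _ => by omega,
        Finset.sum_empty, mul_zero]
      exact ⟨0, 0, by simp, by simp⟩
  · intro hq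
    have hn : k + q - 1 = n := by omega
    refine ⟨startPos (m + n - 1) k, _, ctMap_monomial_mul_magogKernel hk, ?_⟩
    rw [MvPowerSeries.coeff_C_mul, coeff_prod_stepSeries_mul_signSeries m n (strictMono_startPos hk),
      magogGenFun_eq hk hkn (by omega) fun h => absurd h (by omega), hn]
    rfl
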